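/- Consider the Petri net with places $p_1,p_2,p_3,p_4$ and transitions $a,b,c,d,e$ whose presets and postsets are $a:\{p_1\}\to\{p_1\}$, $b:\{p_1\}\to\{p_2\}$, $c:\{p_2,p_3\}\to\{p_1,p_3\}$, $d:\{p_3,p_4\}\to\{p_3,p_4\}$, $e:\{p_4\}\to\{p_4\}$, with initial marking $M_0$ having one token in each of $p_1,p_3,p_4$ and none in $p_2$. Two transitions are independent when no place belongs to the preset or postset of both. Let $\mathcal M$ be the trace monoid generated by the transitions, with independent transitions commuting, and let $|x|$ be the length of a trace $x$. Let $\mathcal M$ act on the right on $X\cup\{\bot\}$, where $X$ is the set of reachable markings: $M\cdot(t_1\cdots t_k)$ is the marking reached from $M$ by firing $t_1,\dots,t_k$ in this order if that is possible, and $\bot$ otherwise. A clique is a (possibly empty) product of pairwise independent letters, and $\gamma\to\gamma'$ means that each letter $b$ of $\gamma'$ has a letter of $\gamma$ not independent of $b$. The boundary $\partial\mathcal M$ is the set of sequences $\xi=(\gamma_1,\gamma_2,\dots)$ of nonempty cliques with $\gamma_i\to\gamma_{i+1}$ for all $i$. For $x\in\mathcal M$, $\uparrow x$ is the set of $\xi\in\partial\mathcal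 M$ such that $x$ is a left divisor of $\gamma_1\cdots\gamma_k$ for all large $k$. The Möbius matrix is $M_{s,t}(z)=\sum_{\gamma\text{ clique},\,s\cdot\gamma=t}(-1)^{|\gamma|}z^{|\gamma|}$ for $s,t\in X$, and $\theta(z)=\det M(z)$. The characteristic root $q_0\in(0,1]$ is the common radius of convergence of all the series $G_{s,t}(z)=\sum_{x:\,s\cdot x=t}z^{|x|}$ and $G_s(z)=\sum_{x:\,s\cdot x\ne\bot}z^{|x|}$. The uniform measure is the family $(\nu_s)_{s\in X}$ of probability measures on $\partial\mathcal M$ such that, for each $s$, the measures $G_s(q)^{-1}\sum_{x:\,s\cdot x\ne\bot}q^{|x|}\delta_x$ converge weakly to $\nu_s$ as $q\to q_0^-$, in the space $\mathcal M\cup\partial\mathcal M$ of sequences of possibly empty cliques with $\gamma_i\to\gamma_{i+1}$ for all $i$ (product topology), where a finite trace is identified with its normal form (the unique sequence $\gamma_1\to\cdots\to\gamma_n$ of nonempty cliques with product $x$) followed by empty cliques. Then: 1. The net is safe, and it has exactly two reachable markings, $M_0$ and the marking $M_1\neq M_0$ obtained from $M_0$ by firing $b$. The pairs of independent transitions are $ad,ae,bd,be,ce$.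 The action is given by $M_0\cdot a=M_0\cdot d=M_0\cdot e=M_0$, $M_0\cdot b=M_1$, $M_0\cdot c=\bot$, $M_1\cdot a=M_1\cdot b=\bot$, $M_1\cdot c=M_0$, $M_1\cdot d=M_1\cdot e=M_1$. It is irreducible: for all $s,t\in X$ there is $x\in\mathcal M$, $x\ne\varepsilon$, with $s\cdot x=t$. 2. $M(z)=\begin{pmatrix}1-3z+2z^2&-z+2z^2\\-z+z^2&1-2z\end{pmatrix}$ (rows and columns indexed by $M_0,M_1$) and $\theta(z)=(1-z)(1-2z)(1-2z-z^2)$. The characteristic root exists and is $q_0=\sqrt2-1$, which is the smallest positive root of $\theta$. 3. The uniform measure $\nu$ exists and is unique. There is a unique $\Gamma:X\times X\to(0,\infty)$ with $\Gamma(s,u)=\Gamma(s,t)\Gamma(t,u)$ for all $s,t,u\in X$ and $\nu_s(\uparrow x)=q_0^{|x|}\,\Gamma(s,s\cdot x)$ whenever $s\cdot x\ne\bot$. It satisfies $\Gamma(M_0,M_0)=\Gamma(M_1,M_1)=1$, $\Gamma(M_0,M_1)=\sqrt2$ and $\Gamma(M_1,M_0)=1/\sqrt2$. 4. For every $x\in\mathcal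 M$: $\nu_{M_0}(\uparrow x)$ equals $(\sqrt2-1)^{|x|}$ if $M_0\cdot x=M_0$, $\sqrt2\,(\sqrt2-1)^{|x|}$ if $M_0\cdot x=M_1$, and $0$ if $M_0\cdot x=\bot$; $\nu_{M_1}(\uparrow x)$ equals $(\sqrt2-1)^{|x|}$ if $M_1\cdot x=M_1$, $\frac1{\sqrt2}(\sqrt2-1)^{|x|}$ if $M_1\cdot x=M_0$, and $0$ if $M_1\cdot x=\bot$. -/

import Mathlib

open Filter Topology MeasureTheory
open scoped ENNReal BoundedContinuousFunction

namespace AsyncNet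

section TraceMonoid

variable {α : Type*}

/-- The relations `ab = ba` for all independent pairs `(a, b)`. The independence relation, a
symmetric and irreflexive relation on the alphabet `α`, is the adjacency relation of a
`SimpleGraph`. -/
inductive CommRel (I : SimpleGraph α) : FreeMonoid α → FreeMonoid α → Prop
  | swap {a b : α} (h : I.Adj a b) :
      CommRel I (FreeMonoid.of a * FreeMonoid.of b) (FreeMonoid.of b * FreeMonoid.of a)

/-- The trace monoid `⟨α | ab = ba for all (a, b) ∈ I⟩`. -/
abbrev Trace (I : SimpleGraph α) : Type _ := PresentedMonoid (CommRel I)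

/-- A letter, as a trace. -/
def letter (I : SimpleGraph α) (a : α) : Trace I := PresentedMonoid.of (CommRel I) a

theorem letter_commute {I : SimpleGraph α} {a b : α} (h : I.Adj a b) :
    Commute (letter I a) (letter I b) := by
  have := PresentedMonoid.mk_eq_mk_of_rel (CommRel.swap h)
  rw [map_mul, map_mul] at this
  exact this

/-- The length of traces, as a homomorphism: every letter has length `1`. -/
def lengthHom (I : SimpleGraph α) : Trace I →* Multiplicative ℕ :=
  PresentedMonoid.lift (fun _ => Multiplicative.ofAdd 1) (by
    rintro _ _ ⟨_⟩
    simp)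

/-- The length `|x|` of a trace. -/
def Trace.length {I : SimpleGraph α} (x : Trace I) : ℕ := Multiplicative.toAdd (lengthHom I x)

/-- A clique of the trace monoid, i.e. a product of pairwise independent letters, given by the
finite set of its letters (which determines it). The empty clique `ε` is included. -/
@[ext]
structure Clique (I : SimpleGraph α) where
  letters : Finset α
  isClique : I.IsClique (letters : Set α)

instance (I : SimpleGraph α) : TopologicalSpace (Clique I) := ⊥
instance (I : SimpleGraph α) : DiscreteTopology (Clique I) := ⟨rfl⟩
instance (I : SimpleGraph α) : MeasurableSpace (Clique I) := ⊤

instance (I : SimpleGraph α) [Finite α] : Finite (Clique I) :=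
  Finite.of_injective (fun γ : Clique I => γ.letters) (fun _ _ h => Clique.ext h)

noncomputable instance (I : SimpleGraph α) [Finite α] : Fintype (Clique I) := Fintype.ofFinite _

theorem Clique.commute {I : SimpleGraph α} (γ : Clique I) :
    (γ.letters : Set α).Pairwise (Function.onFun Commute (letter I)) :=
  fun _ ha _ hb hab => letter_commute (γ.isClique ha hb hab)

/-- The clique as an element of the trace monoid: the product of its (commuting) letters. -/
def Clique.toTrace {I : SimpleGraph α} (γ : Clique I) : Trace I :=
  γ.letters.noncommProd (letter I) γ.commute

/-- The relation `γ → γ'`: each letter `b` of `γ'` has a letter `a` of `γ` with `(a, b) ∉ I`. -/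
def Clique.Normal {I : SimpleGraph α} (γ γ' : Clique I) : Prop :=
  ∀ b ∈ γ'.letters, ∃ a ∈ γ.letters, ¬ I.Adj a b

/-- Generalized traces (finite or infinite): infinite normal sequences of possibly empty cliques,
with the topology and the Borel structure of the product of the discrete spaces of cliques.
A finite trace with normal form `(γ₁, …, γₙ)` corresponds to `(γ₁, …, γₙ, ε, ε, …)`. -/
abbrev GenTrace (I : SimpleGraph α) : Type _ :=
  {ξ : ℕ → Clique I // ∀ i, (ξ i).Normal (ξ (i + 1))}

/-- The boundary of the trace monoid: infinite traces, i.e. infinite normal sequences of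
nonempty cliques. -/
abbrev Boundary (I : SimpleGraph α) : Type _ :=
  {ξ : ℕ → Clique I // (∀ i, (ξ i).letters.Nonempty) ∧ ∀ i, (ξ i).Normal (ξ (i + 1))}

/-- Infinite traces as generalized traces. -/
def Boundary.toGen {I : SimpleGraph α} (ξ : Boundary I) : GenTrace I := ⟨ξ.1, ξ.2.2⟩

/-- The product of the first `k` cliques of a sequence. -/
def partialProd {I : SimpleGraph α} (ξ : ℕ → Clique I) : ℕ → Trace I
  | 0 => 1
  | k + 1 => partialProd ξ k * (ξ k).toTrace

/-- The visual cylinder `↑x`: infinite traces `ξ = (γ₁, γ₂, …)` such that `x` is a left divisor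
of `γ₁ ⋯ γₖ` for all `k` large enough. -/
def visualCylinder {I : SimpleGraph α} (x : Trace I) : Set (Boundary I) :=
  {ξ | ∀ᶠ k in atTop, ∃ z : Trace I, partialProd ξ.1 k = x * z}

theorem exists_normalForm_word {I : SimpleGraph α} (w : List α) :
    ∃ ξ : GenTrace I, ∃ n, (∀ k, n ≤ k → (ξ.1 k).letters = ∅) ∧
      partialProd ξ.1 n = (w.map (letter I)).prod := by
  classical
  induction w using List.reverseRecOn with
  | nil =>
    refine ⟨⟨fun _ => ⟨∅, by simp⟩, fun i b hb => by simp at hb⟩, 0, fun k _ => rfl, rfl⟩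
  | append_singleton w b ih =>
    obtain ⟨⟨ξ, hξ⟩, n, hn, hp⟩ := ih
    simp only at hn hp
    have hex : ∃ j, ∀ i, j ≤ i → ∀ a ∈ (ξ i).letters, I.Adj a b :=
      ⟨n, fun i hi a ha => by simp [hn i hi] at ha⟩
    let j := Nat.find hex
    have hj : ∀ i, j ≤ i → ∀ a ∈ (ξ i).letters, I.Adj a b := Nat.find_spec hex
    have hjn : j ≤ n := Nat.find_min' hex fun i hi a ha => by simp [hn i hi] at ha
    have hbj : b ∉ (ξ j).letters := fun h => I.irrefl (hj j le_rfl b h)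
    let δ : Clique I := ⟨insert b (ξ j).letters, by
      rw [Finset.coe_insert, SimpleGraph.isClique_insert]
      exact ⟨(ξ j).isClique, fun a ha _ => (hj j le_rfl a ha).symm⟩⟩
    let ξ' : ℕ → Clique I := Function.update ξ j δ
    have hδ : ξ' j = δ := by simp [ξ']
    have hne : ∀ i, i ≠ j → ξ' i = ξ i := fun i hi => by simp [ξ', hi]
    have hδp : δ.toTrace = (ξ j).toTrace * letter I b :=
      Finset.noncommProd_insert_of_notMem' _ _ _ δ.commute hbj
    refine ⟨⟨ξ', fun i => ?_⟩, n + 1, fun k hk => ?_, ?_⟩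
    · by_cases hi : i = j
      · subst hi
        rw [hδ, hne (j + 1) (by omega)]
        intro c hc
        obtain ⟨a, ha, hac⟩ := hξ j c hc
        exact ⟨a, Finset.mem_insert_of_mem ha, hac⟩
      · rw [hne i hi]
        by_cases hi' : i + 1 = j
        · rw [hi', hδ]
          intro c hc
          rcases Finset.mem_insert.1 hc with rfl | hc
          · by_contra! hcon
            have := Nat.find_min' hex (m := i) (fun l hl a ha => by
              rcases hl.eq_or_lt with rfl | hl
              · exact hcon a ha
              · exact hj l (by omega) a ha)
            omega
          · exact hξ i c (hi' ▸ hc)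
        · rw [hne _ hi']
          exact hξ i
    · simp only
      rw [hne k (by omega)]
      exact hn k (by omega)
    · have h1 : ∀ k, k ≤ j → partialProd ξ' k = partialProd ξ k := by
        intro k
        induction k with
        | zero => intro _; rfl
        | succ k ih =>
          intro hk
          rw [partialProd, partialProd, ih (by omega), hne k (by omega)]
      have h2 : ∀ k, j + 1 ≤ k → partialProd ξ' k = partialProd ξ k * letter I b := by
        intro k hk
        induction k, hk using Nat.le_induction with
        | base => rw [partialProd, partialProd, h1 j le_rfl, hδ, hδp, mul_assoc]
        | succ k hk ih =>
          rw [partialProd, partialProd, ih, hne k (by omega), mul_assoc, mul_assoc]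
          congr 1
          exact Finset.noncommProd_commute _ _ _ _
            fun a ha => letter_commute (hj k (by omega) a ha).symm
      have h3 : (ξ n).toTrace = 1 := by
        have : ξ n = ⟨∅, by simp⟩ := Clique.ext (hn n le_rfl)
        rw [this]
        rfl
      rw [h2 _ (by omega), partialProd, h3, hp]
      simp

/-- Existence of the normal form, padded by empty cliques. -/
theorem exists_normalForm {I : SimpleGraph α} (x : Trace I) :
    ∃ ξ : GenTrace I, ∃ n, (∀ k, n ≤ k → (ξ.1 k).letters = ∅) ∧ partialProd ξ.1 n = x := by
  obtain ⟨w, rfl⟩ := PresentedMonoid.surjective_mk x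
  obtain ⟨ξ, n, h, hp⟩ := exists_normalForm_word (I := I) w.toList
  refine ⟨ξ, n, h, hp.trans ?_⟩
  clear hp h
  induction w using FreeMonoid.inductionOn' with
  | one => simp
  | of_mul a w ih => simp [ih, letter, PresentedMonoid.of]

/-- The normal form of a trace, padded by empty cliques. This embeds the trace monoid into the
space of generalized traces. -/
noncomputable def normalForm {I : SimpleGraph α} (x : Trace I) : GenTrace I :=
  (exists_normalForm x).choose

instance (I : SimpleGraph α) : MeasurableSpace (Trace I) := ⊤

end TraceMonoid

section System

variable {α : Type*} {I : SimpleGraph α} {X : Type*}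

/-- An asynchronous system: a right action of the trace monoid on `Y = X ∪ {⊥}` fixing the
state `⊥`, which is `none : Option X`. -/
structure AsyncSystem (I : SimpleGraph α) (X : Type*) where
  act : Option X → Trace I → Option X
  act_one : ∀ s, act s 1 = s
  act_mul : ∀ s x y, act s (x * y) = act (act s x) y
  act_bot : ∀ x, act none x = none

namespace AsyncSystem

variable (S : AsyncSystem I X)

/-- The action is irreducible. -/
def Irreducible : Prop := ∀ s t : X, ∃ x : Trace I, x ≠ 1 ∧ S.act (some s) x = some t

/-- The entry `G_{s,t}(z) = ∑_{x : s·x = t} z^{|x|}` of the growth matrix. -/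
noncomputable def growthEntry (s t : X) : PowerSeries ℕ :=
  PowerSeries.mk fun k => Nat.card {x : Trace I // S.act (some s) x = some t ∧ x.length = k}

/-- The growth series `G_s(z)` of the set of traces `x` with `s·x ≠ ⊥`. -/
noncomputable def growth (s : X) : PowerSeries ℕ :=
  PowerSeries.mk fun k => Nat.card {x : Trace I // S.act (some s) x ≠ none ∧ x.length = k}

end AsyncSystem

/-- The radius of convergence of a power series with coefficients in `ℕ`. -/
noncomputable def convRadius (f : PowerSeries ℕ) : ℝ≥0∞ :=
  (FormalMultilinearSeries.ofScalars ℝ (fun k => ((PowerSeries.coeff k f : ℕ) : ℝ))).radius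

/-- The sum in `[0, ∞]` of a power series with coefficients in `ℕ` at a real `q ≥ 0`. -/
noncomputable def evalSeries (f : PowerSeries ℕ) (q : ℝ) : ℝ≥0∞ :=
  ∑' k, ((PowerSeries.coeff k f : ℕ) : ℝ≥0∞) * ENNReal.ofReal q ^ k

namespace AsyncSystem

variable (S : AsyncSystem I X)

open Classical in
/-- The Möbius matrix `M_{s,t}(z) = ∑_{γ clique, s·γ = t} (-1)^{|γ|} z^{|γ|}`. -/
noncomputable def mobiusMatrix [Finite α] : Matrix X X (Polynomial ℤ) :=
  Matrix.of fun s t => ∑ γ : Clique I with S.act (some s) γ.toTrace = some t,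
    (-1) ^ γ.toTrace.length * Polynomial.X ^ γ.toTrace.length

open Classical in
/-- The theta polynomial `θ(z) = det M(z)`. -/
noncomputable def theta [Finite α] [Finite X] : Polynomial ℤ :=
  letI := Fintype.ofFinite X
  S.mobiusMatrix.det

/-- `q₀` is the characteristic root: the common radius of convergence, in `(0, 1]`, of all the
entries of the growth matrix and of all the growth series. -/
def IsCharacteristicRoot (q₀ : ℝ) : Prop :=
  q₀ ∈ Set.Ioc 0 1 ∧ (∀ s t, convRadius (S.growthEntry s t) = ENNReal.ofReal q₀) ∧
    ∀ s, convRadius (S.growth s) = ENNReal.ofReal q₀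

/-- The discrete measure `m_{s,q} = G_s(q)⁻¹ ∑_{x : s·x ≠ ⊥} q^{|x|} δ_x` on the trace monoid. -/
noncomputable def discreteMeasure (s : X) (q : ℝ) : Measure (Trace I) :=
  (evalSeries (S.growth s) q)⁻¹ •
    Measure.sum fun x : {x : Trace I // S.act (some s) x ≠ none} =>
      ENNReal.ofReal q ^ x.1.length • Measure.dirac x.1

/-- `ν` is the uniform measure: for every state `s`, the measures `m_{s,q}` converge weakly, as
`q → q₀` from below, to the probability measure `ν s` on the boundary (the convergence takes
place in the space of finite or infinite traces). -/
def IsUniformMeasure (ν : X → ProbabilityMeasure (Boundary I)) : Prop :=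
  ∃ q₀, S.IsCharacteristicRoot q₀ ∧ ∀ s, ∀ f : GenTrace I →ᵇ ℝ,
    Tendsto (fun q : ℝ => ∫ x, f (normalForm x) ∂(S.discreteMeasure s q)) (𝓝[<] q₀)
      (𝓝 (∫ ξ, f ξ.toGen ∂(ν s : Measure (Boundary I))))

/-- `Γ` is a positive cocycle with `ν_s(↑x) = q₀^{|x|} Γ(s, s·x)` whenever `s·x ≠ ⊥`. -/
def IsCocycleOf (ν : X → ProbabilityMeasure (Boundary I)) (Γ : X → X → ℝ) : Prop :=
  (∀ s t, 0 < Γ s t) ∧ (∀ s t u, Γ s u = Γ s t * Γ t u) ∧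
  ∃ q₀, S.IsCharacteristicRoot q₀ ∧ ∀ s t (x : Trace I), S.act (some s) x = some t →
    (ν s : Measure (Boundary I)).real (visualCylinder x) = q₀ ^ x.length * Γ s t

end AsyncSystem

end System

section Petri

/-- Petri nets with set of places `P` and set of transitions `T`. The flow relation is a subset of
`(P × T) ∪ (T × P)`, and presets and postsets are nonempty. -/
structure PetriNet (P T : Type*) where
  flow : Set ((P × T) ⊕ (T × P))
  pre_nonempty : ∀ t, {p : P | Sum.inl (p, t) ∈ flow}.Nonempty
  post_nonempty : ∀ t, {p : P | Sum.inr (t, p) ∈ flow}.Nonempty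
  init : P → ℕ

namespace PetriNet

variable {P T : Type*} (N : PetriNet P T)

/-- The preset of a transition. -/
def pre (t : T) : Set P := {p | Sum.inl (p, t) ∈ N.flow}

/-- The postset of a transition. -/
def post (t : T) : Set P := {p | Sum.inr (t, p) ∈ N.flow}

/-- The marking `M` enables the transition `t`. -/
def Enabled (M : P → ℕ) (t : T) : Prop := ∀ p ∈ N.pre t, 0 < M p

open Classical in
/-- The marking obtained from `M` by firing `t` (meaningful if `M` enables `t`). -/
noncomputable def fire (M : P → ℕ) (t : T) : P → ℕ := fun p =>
  if p ∈ N.pre t \ N.post t then M p - 1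
  else if p ∈ N.post t \ N.pre t then M p + 1
  else M p

/-- `N.FiresTo M l M'`: `l` is a firing sequence from `M`, which leads to `M'`. -/
def FiresTo : (P → ℕ) → List T → (P → ℕ) → Prop
  | M, [], M' => M' = M
  | M, t :: l, M' => N.Enabled M t ∧ FiresTo (N.fire M t) l M'

/-- Markings reachable from the initial marking. -/
def Reachable (M : P → ℕ) : Prop := ∃ l, N.FiresTo N.init l M

/-- The net is (1-)safe. -/
def Safe : Prop := ∀ M, N.Reachable M → ∀ p, M p ≤ 1

/-- The states of the net: the reachable markings. -/
abbrev State : Type _ := {M : P → ℕ // N.Reachable M}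

theorem finite_state [Finite P] (h : N.Safe) : Finite N.State := by
  refine Finite.of_injective (β := P → Fin 2)
    (fun M p => ⟨M.1 p, Nat.lt_succ_of_le (h M.1 M.2 p)⟩) fun M M' hM => ?_
  ext p
  simpa using congrFun hM p

/-- Independence of transitions: `t` and `t'` are independent when they are distant. -/
def indep : SimpleGraph T where
  Adj t t' := Disjoint (N.pre t ∪ N.post t) (N.pre t' ∪ N.post t')
  symm := ⟨fun _ _ h => h.symm⟩
  loopless := ⟨fun t h => by
    obtain ⟨p, hp⟩ := N.pre_nonempty t
    exact Set.disjoint_left.1 h (Or.inl hp) (Or.inl hp)⟩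

theorem firesTo_append {M M' M'' : P → ℕ} {l l' : List T} (h : N.FiresTo M l M')
    (h' : N.FiresTo M' l' M'') : N.FiresTo M (l ++ l') M'' := by
  induction l generalizing M with
  | nil =>
    simp only [FiresTo] at h
    subst h
    exact h'
  | cons t l ih => exact ⟨h.1, ih h.2⟩

theorem reachable_fire {M : P → ℕ} (hM : N.Reachable M) {t : T} (h : N.Enabled M t) :
    N.Reachable (N.fire M t) := by
  obtain ⟨l, hl⟩ := hM
  exact ⟨l ++ [t], N.firesTo_append hl ⟨h, rfl⟩⟩

theorem reachable_init : N.Reachable N.init := ⟨[], rfl⟩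

open Classical in
/-- The action of one transition on `State ∪ {⊥}`. -/
noncomputable def step (t : T) : Option N.State → Option N.State
  | none => none
  | some M => if h : N.Enabled M.1 t then some ⟨N.fire M.1 t, N.reachable_fire M.2 h⟩ else none

theorem enabled_fire_iff {M : P → ℕ} {t t' : T} (h : N.indep.Adj t t') :
    N.Enabled (N.fire M t) t' ↔ N.Enabled M t' := by
  refine forall₂_congr fun p hp => ?_
  have hp' : p ∉ N.pre t ∪ N.post t := fun hp' => Set.disjoint_left.1 h hp' (Or.inl hp)
  have h1 : p ∉ N.pre t \ N.post t := fun hq => hp' (Or.inl hq.1)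
  have h2 : p ∉ N.post t \ N.pre t := fun hq => hp' (Or.inr hq.1)
  simp only [fire, if_neg h1, if_neg h2]

theorem fire_comm {M : P → ℕ} {t t' : T} (h : N.indep.Adj t t') :
    N.fire (N.fire M t) t' = N.fire (N.fire M t') t := by
  funext p
  have hp : p ∈ N.pre t ∪ N.post t → p ∉ N.pre t' ∪ N.post t' :=
    fun hp => Set.disjoint_left.1 h hp
  simp only [Set.mem_union, not_or] at hp
  simp only [fire, Set.mem_sdiff]
  grind

theorem step_comm {t t' : T} (h : N.indep.Adj t t') (s : Option N.State) :
    N.step t' (N.step t s) = N.step t (N.step t' s) := by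
  cases s with
  | none => rfl
  | some M =>
    by_cases h1 : N.Enabled M.1 t <;> by_cases h2 : N.Enabled M.1 t' <;>
      simp [step, h1, h2, N.enabled_fire_iff h, N.enabled_fire_iff h.symm, N.fire_comm h]

/-- The action of traces: a trace acts by firing its letters from left to right. -/
noncomputable def actHom : Trace N.indep →* (Function.End (Option N.State))ᵐᵒᵖ :=
  PresentedMonoid.lift
    (fun t => (MulOpposite.op (N.step t) : (Function.End (Option N.State))ᵐᵒᵖ)) (by
    rintro _ _ ⟨h⟩
    simp only [map_mul, FreeMonoid.lift_eval_of]
    exact congrArg MulOpposite.op (funext fun s => N.step_comm h s))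

/-- The asynchronous system of a Petri net. -/
noncomputable def system : AsyncSystem N.indep N.State where
  act s x := (N.actHom x).unop s
  act_one s := by rw [map_one]; rfl
  act_mul s x y := by rw [map_mul]; rfl
  act_bot x := by
    obtain ⟨w, rfl⟩ := PresentedMonoid.surjective_mk x
    induction w using FreeMonoid.inductionOn' with
    | one => rw [map_one, map_one]; rfl
    | of_mul t w ih => rw [map_mul, map_mul]; exact ih

/-- The action is as expected: `M·(t₁ ⋯ tₖ) = M'` if and only if `(t₁, …, tₖ)` is a firing
sequence from `M` leading to `M'`. -/
theorem system_act_eq_some_iff (M M' : N.State) (l : List T) :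
    N.system.act (some M) ((l.map (letter N.indep)).prod) = some M' ↔ N.FiresTo M.1 l M'.1 := by
  induction l generalizing M with
  | nil =>
    rw [List.map_nil, List.prod_nil, N.system.act_one, FiresTo, Option.some_inj, Subtype.ext_iff,
      eq_comm]
  | cons t l ih =>
    rw [List.map_cons, List.prod_cons, N.system.act_mul]
    change N.system.act (N.step t (some M)) _ = _ ↔ _
    by_cases h : N.Enabled M.1 t
    · simp only [step, h, dif_pos, ih, FiresTo, true_and]
    · simp only [step, h, dif_neg, FiresTo, false_and, N.system.act_bot, not_false_eq_true]
      simp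

end PetriNet

end Petri

section Example

/-- The four places of the net. -/
inductive Pl
  | p₁ | p₂ | p₃ | p₄
  deriving DecidableEq

instance : Fintype Pl := ⟨{.p₁, .p₂, .p₃, .p₄}, fun p => by cases p <;> decide⟩

/-- The five transitions of the net. -/
inductive Tr
  | a | b | c | d | e
  deriving DecidableEq

instance : Fintype Tr := ⟨{.a, .b, .c, .d, .e}, fun t => by cases t <;> decide⟩

open Pl Tr

/-- The net with presets and postsets `a : {p₁} → {p₁}`, `b : {p₁} → {p₂}`,
`c : {p₂, p₃} → {p₁, p₃}`, `d : {p₃, p₄} → {p₃, p₄}`, `e : {p₄} → {p₄}`, whose initial marking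
has one token in each of `p₁`, `p₃`, `p₄`. -/
def net : PetriNet Pl Tr where
  flow := {.inl (p₁, a), .inr (a, p₁),
    .inl (p₁, b), .inr (b, p₂),
    .inl (p₂, c), .inl (p₃, c), .inr (c, p₁), .inr (c, p₃),
    .inl (p₃, d), .inl (p₄, d), .inr (d, p₃), .inr (d, p₄),
    .inl (p₄, e), .inr (e, p₄)}
  pre_nonempty t := by
    cases t
    exacts [⟨p₁, by simp⟩, ⟨p₁, by simp⟩, ⟨p₂, by simp⟩, ⟨p₃, by simp⟩, ⟨p₄, by simp⟩]
  post_nonempty t := by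
    cases t
    exacts [⟨p₁, by simp⟩, ⟨p₂, by simp⟩, ⟨p₁, by simp⟩, ⟨p₃, by simp⟩, ⟨p₄, by simp⟩]
  init
    | p₁ => 1
    | p₂ => 0
    | p₃ => 1
    | p₄ => 1

theorem net_enabled_b : net.Enabled net.init b := by
  intro p hp
  cases p <;> simp [PetriNet.pre, net] at hp ⊢

/-- The initial marking. -/
def M₀ : net.State := ⟨net.init, net.reachable_init⟩

/-- The marking obtained from `M₀` by firing `b`. -/
noncomputable def M₁ : net.State :=
  ⟨net.fire net.init b, net.reachable_fire net.reachable_init net_enabled_b⟩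

theorem net_fire_eq {M : Pl → ℕ} (hM : M = M₀.1 ∨ M = M₁.1) {t : Tr} (h : net.Enabled M t) :
    net.fire M t = M₀.1 ∨ net.fire M t = M₁.1 := by
  have e : M₁.1 = fun p => match p with | p₁ => 0 | p₂ => 1 | p₃ => 1 | p₄ => 1 := by
    funext p
    cases p <;> simp [M₁, PetriNet.fire, PetriNet.pre, PetriNet.post, net]
  rw [e] at hM ⊢
  have h0 := h p₁
  have h1 := h p₂
  rcases hM with rfl | rfl <;> cases t <;>
    simp [M₀, PetriNet.pre, net] at h0 h1 <;>
    first
    | (left; funext p; cases p <;> simp [M₀, PetriNet.fire, PetriNet.pre, PetriNet.post, net]; done)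
    | (right; funext p; cases p <;> simp [M₀, PetriNet.fire, PetriNet.pre, PetriNet.post, net])

theorem net_firesTo {M M' : Pl → ℕ} {l : List Tr} (hM : M = M₀.1 ∨ M = M₁.1)
    (h : net.FiresTo M l M') : M' = M₀.1 ∨ M' = M₁.1 := by
  induction l generalizing M with
  | nil =>
    simp only [PetriNet.FiresTo] at h
    exact h ▸ hM
  | cons t l ih => exact ih (net_fire_eq hM h.1) h.2

theorem net_safe : net.Safe := by
  rintro M ⟨l, hl⟩ p
  rcases net_firesTo (Or.inl rfl) hl with rfl | rfl <;> cases p <;>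
    simp [M₀, M₁, PetriNet.fire, PetriNet.pre, PetriNet.post, net]

instance : Finite net.State := net.finite_state net_safe

end Example

end AsyncNet

open AsyncNet

/-! The measure `m_{s,q}` gives explicit mass to the multiples of a trace. If `s·x = t`, left
cancellation identifies the multiples `x * z` that act from `s` with the traces `z` that act from
`t`. Hence the multiples of `x` have mass `q^|x| G_t(q) / G_s(q)`. The whole result then rests on
the behaviour of the ratios `G_t / G_s` at the common singularity.

The growth series come from Möbius inversion: the letters dividing a trace form a clique, so the
alternating sum over the cliques dividing `y` vanishes unless `y = 1`. With left cancellation this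
says that the Möbius matrix times the growth matrix is the identity
(`sum_mobiusMatrix_mul_growthEntry`). For the net, all entries share the factor `1/(1 - 2z - z^2)`,
whose pole `√2 - 1` precedes the other roots `1/2` and `1` of `θ`. Both `G_s` diverge there, while
the factor cancels in `G_{M₁}/G_{M₀}`, which tends to `√2`. This limit is the cocycle.

Convergence on cylinders gives weak convergence because divisibility by `x` is decided by the first
`|x|` cliques (`dvd_partialProd_length`). Cylinders are therefore clopen; they also form a π-system
that generates the Borel sets of a compact space, so there is exactly one limit
(`exists_tendsto_of_tendsto_genCylinder`). Since `G_s` diverges, any finite set of traces loses its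
mass, and the limit lives on the boundary (`exists_tendsto_discreteMeasure`). Irreducibility makes
the cocycle unique. -/

namespace AsyncNet

/-! ### Division, cancellation and normal forms in trace monoids -/

section Combinatorics

variable {α : Type*} {I : SimpleGraph α}

theorem Trace.inductionOn_letter {p : Trace I → Prop} (x : Trace I) (one : p 1)
    (mul : ∀ a x, p x → p (letter I a * x)) : p x := by
  obtain ⟨w, rfl⟩ := PresentedMonoid.surjective_mk x
  induction w using FreeMonoid.inductionOn' with
  | one => rwa [map_one]
  | of_mul a w ih => rw [map_mul]; exact mul a _ ih

@[simp] theorem Trace.length_one : (1 : Trace I).length = 0 := by simp [Trace.length]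

@[simp] theorem Trace.length_mul (x y : Trace I) : (x * y).length = x.length + y.length := by
  simp [Trace.length]

@[simp] theorem Trace.length_letter (a : α) : (letter I a).length = 1 := by
  change Multiplicative.toAdd (lengthHom I (PresentedMonoid.of _ a)) = 1
  rw [lengthHom, PresentedMonoid.lift_of]
  rfl

theorem Trace.length_eq_zero {x : Trace I} : x.length = 0 ↔ x = 1 := by
  refine ⟨fun h => ?_, fun h => by simp [h]⟩
  induction x using Trace.inductionOn_letter with
  | one => rfl
  | mul a x _ => simp at h

/-- Left multiplication by the letter `b` on pairs `(y, o)`, where `o` is the quotient of `y` by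
the letter `a` on the left, if it exists. -/
noncomputable def quotStep (I : SimpleGraph α) (a b : α) :
    Function.End (Trace I × Option (Trace I)) := fun p =>
  open Classical in
  (letter I b * p.1, if b = a then some p.1 else if I.Adj a b then p.2.map (letter I b * ·)
    else none)

/-- The action of traces on pairs obtained by iterating `quotStep`. -/
noncomputable def quotHom (I : SimpleGraph α) (a : α) :
    Trace I →* Function.End (Trace I × Option (Trace I)) :=
  PresentedMonoid.lift (quotStep I a) (by
    rintro _ _ ⟨h⟩
    rename_i b c
    simp only [map_mul, FreeMonoid.lift_eval_of]
    funext ⟨y, o⟩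
    have hbc : b ≠ c := h.ne
    have hcomm : ∀ z, letter I b * (letter I c * z) = letter I c * (letter I b * z) := fun z => by
      rw [← mul_assoc, (letter_commute h).eq, mul_assoc]
    have h' := h.symm
    simp only [Function.End.mul_def, Function.comp, quotStep, hcomm]
    congr 1
    -- If one of `b`, `c` is `a`, the other is independent of `a` and passes through the quotient.
    -- Otherwise both orders give `none` unless both letters are independent of `a`, and then `b`
    -- and `c` commute in front of the quotient.
    by_cases hb : b = a
    · subst hb
      simp [hbc.symm, h]
    · by_cases hc : c = a
      · subst hc
        simp [hb, h']
      · by_cases h1 : I.Adj a b <;> by_cases h2 : I.Adj a c <;> simp [hb, hc, h1, h2]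
        cases o <;> simp [(letter_commute h).eq])

/-- The quotient of `x` by the letter `a` on the left, if `a` divides `x`. -/
noncomputable def quot (a : α) (x : Trace I) : Option (Trace I) := (quotHom I a x (1, none)).2

theorem quotHom_fst (a : α) (x : Trace I) : (quotHom I a x (1, none)).1 = x := by
  induction x using Trace.inductionOn_letter with
  | one => simp [Function.End.one_def]
  | mul b x ih =>
    rw [map_mul, Function.End.mul_def]
    change letter I b * _ = _
    rw [ih]

open Classical in
theorem quot_letter_mul (a b : α) (x : Trace I) : quot a (letter I b * x) =
    if b = a then some x else if I.Adj a b then (quot a x).map (letter I b * ·) else none := by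
  rw [quot, map_mul, Function.End.mul_def]
  change (if b = a then some (quotHom I a x (1, none)).1 else _) = _
  rw [quotHom_fst]
  rfl

/-- Shows that the recursively defined quotient really is left division. As a function it has a
single value on `letter I a * y`, which gives cancellation and Levi's lemma at once. -/
theorem quot_eq_some_iff {a : α} {x y : Trace I} : quot a x = some y ↔ x = letter I a * y := by
  refine ⟨fun h => ?_, fun h => by simp [h, quot_letter_mul]⟩
  induction x using Trace.inductionOn_letter generalizing y with
  | one => simp [quot, Function.End.one_def] at h
  | mul b x ih =>
    rw [quot_letter_mul] at h
    split_ifs at h with h1 h2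
    · simp_all
    · obtain ⟨z, hz, rfl⟩ := Option.map_eq_some_iff.1 h
      rw [ih hz, ← mul_assoc, ← mul_assoc, (letter_commute h2).eq]

theorem letter_mul_left_cancel {a : α} {x y : Trace I} (h : letter I a * x = letter I a * y) :
    x = y := by
  have := quot_eq_some_iff.2 h
  simpa [quot_letter_mul] using this

instance : IsLeftCancelMul (Trace I) where
  mul_left_cancel x y z h := by
    induction x using Trace.inductionOn_letter with
    | one => simpa using h
    | mul a x ih =>
      simp only [mul_assoc] at h
      exact ih (letter_mul_left_cancel h)

/-- Levi's lemma for traces, in the case of letters. -/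
theorem letter_mul_eq_letter_mul {a b : α} {x y : Trace I} (hab : a ≠ b)
    (h : letter I a * x = letter I b * y) :
    I.Adj a b ∧ ∃ z, x = letter I b * z ∧ y = letter I a * z := by
  have := quot_eq_some_iff.2 h.symm
  rw [quot_letter_mul, if_neg hab.symm] at this
  split_ifs at this with h1
  obtain ⟨z, hz, rfl⟩ := Option.map_eq_some_iff.1 this
  exact ⟨h1, z, rfl, quot_eq_some_iff.1 hz⟩

theorem letter_dvd_letter_mul {a b : α} {y : Trace I} (hab : a ≠ b) :
    letter I a ∣ letter I b * y ↔ I.Adj a b ∧ letter I a ∣ y := by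
  constructor
  · rintro ⟨z, hz⟩
    obtain ⟨h, w, _, hw⟩ := letter_mul_eq_letter_mul hab hz.symm
    exact ⟨h, w, by assumption⟩
  · rintro ⟨h, z, rfl⟩
    exact ⟨letter I b * z, by rw [← mul_assoc, ← mul_assoc, (letter_commute h).eq]⟩

theorem Clique.induction {p : Clique I → Prop} (γ : Clique I) (empty : p ⟨∅, by simp⟩)
    (insert : ∀ (a : α) (γ δ : Clique I), a ∉ γ.letters → (∀ b, b ∈ δ.letters ↔ b = a ∨ b ∈ γ.letters) →
      (∀ b ∈ γ.letters, I.Adj a b) →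
      δ.toTrace = letter I a * γ.toTrace → p γ → p δ) : p γ := by
  classical
  obtain ⟨s, hs⟩ := γ
  induction s using Finset.induction_on with
  | empty => exact empty
  | insert a s ha ih =>
    have hs' := hs
    rw [Finset.coe_insert, SimpleGraph.isClique_insert] at hs'
    refine insert a ⟨s, hs'.1⟩ _ ha (by simp) (fun b hb => hs'.2 b hb ?_) ?_ (ih hs'.1)
    · rintro rfl
      exact ha hb
    · exact Finset.noncommProd_insert_of_notMem _ _ _ (Clique.commute ⟨_, hs⟩) ha

@[simp] theorem Clique.toTrace_empty : (⟨∅, by simp⟩ : Clique I).toTrace = 1 := rfl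

@[simp] theorem Clique.length_toTrace (γ : Clique I) : γ.toTrace.length = γ.letters.card := by
  classical
  induction γ using Clique.induction with
  | empty => simp
  | insert a γ δ ha hδ _ h ih =>
    have : δ.letters = insert a γ.letters := by ext; simp [hδ]
    rw [h, this, Finset.card_insert_of_notMem ha]
    simp [ih, add_comm]

theorem Clique.letter_dvd {γ : Clique I} {a : α} (ha : a ∈ γ.letters) :
    letter I a ∣ γ.toTrace := by
  induction γ using Clique.induction with
  | empty => simp at ha
  | insert b γ δ hb hδ hadj h ih =>
    rw [h]
    rcases (hδ a).1 ha with rfl | ha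
    · exact dvd_mul_right _ _
    · have hab : a ≠ b := fun e => hb (e ▸ ha)
      exact (letter_dvd_letter_mul hab).2 ⟨(hadj a ha).symm, ih ha⟩

/-- By Levi's lemma, a divisor foreign to the clique must be moved across each of its letters, hence
be independent of all of them. -/
theorem letter_dvd_clique_mul {γ : Clique I} {a : α} {y : Trace I}
    (h : letter I a ∣ γ.toTrace * y) (ha : a ∉ γ.letters) :
    (∀ b ∈ γ.letters, I.Adj b a) ∧ letter I a ∣ y := by
  induction γ using Clique.induction with
  | empty => simpa using h
  | insert b γ δ hb hδ hadj hp ih =>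
    rw [hδ, not_or] at ha
    rw [hp, mul_assoc, letter_dvd_letter_mul ha.1] at h
    obtain ⟨h1, h2⟩ := ih h.2 ha.2
    refine ⟨fun c hc => ?_, h2⟩
    rcases (hδ c).1 hc with rfl | hc
    · exact h.1.symm
    · exact h1 c hc

/-- The letters of the clique can be extracted one at a time: extracting one leaves the other
letters as divisors of what remains. -/
theorem Clique.toTrace_dvd_iff {γ : Clique I} {y : Trace I} :
    γ.toTrace ∣ y ↔ ∀ a ∈ γ.letters, letter I a ∣ y := by
  refine ⟨fun h a ha => (γ.letter_dvd ha).trans h, fun h => ?_⟩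
  induction γ using Clique.induction generalizing y with
  | empty => simp
  | insert b γ δ hb hδ hadj hp ih =>
    obtain ⟨z, rfl⟩ := h b ((hδ b).2 (Or.inl rfl))
    rw [hp]
    refine mul_dvd_mul_left _ (ih fun a ha => ?_)
    have hab : a ≠ b := fun e => hb (e ▸ ha)
    exact ((letter_dvd_letter_mul hab).1 (h a ((hδ a).2 (Or.inr ha)))).2

theorem adj_of_letter_dvd {a b : α} {y : Trace I} (ha : letter I a ∣ y) (hb : letter I b ∣ y)
    (hab : a ≠ b) : I.Adj a b := by
  obtain ⟨z, rfl⟩ := hb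
  exact ((letter_dvd_letter_mul hab).1 ha).1

theorem exists_letter_dvd {x : Trace I} (h : x ≠ 1) : ∃ a, letter I a ∣ x := by
  induction x using Trace.inductionOn_letter with
  | one => exact absurd rfl h
  | mul a x _ => exact ⟨a, dvd_mul_right _ _⟩

theorem mul_dvd_mul_left_iff' (g x y : Trace I) : g * x ∣ g * y ↔ x ∣ y := by
  refine ⟨fun ⟨z, hz⟩ => ⟨z, ?_⟩, fun h => mul_dvd_mul_left _ h⟩
  rw [mul_assoc] at hz
  exact mul_left_cancel hz

/-- If a letter `b` does not divide `x`, but `x` divides a multiple of `b`, then `x` commutes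
with `b`. -/
theorem commute_of_dvd_letter_mul {b : α} {x y : Trace I} (hb : ¬ letter I b ∣ x)
    (h : x ∣ letter I b * y) : Commute (letter I b) x ∧ x ∣ y := by
  obtain ⟨z, hz⟩ := h
  -- Generalized from `x * z` being a given multiple of `b`, so that the induction can strip letters
  -- from `x`: since `b` does not divide `x`, it has to cross every one of them.
  have key : ∀ x z : Trace I, ¬ letter I b ∣ x → letter I b ∣ x * z →
      Commute (letter I b) x ∧ letter I b ∣ z := by
    intro x z
    induction x using Trace.inductionOn_letter with
    | one => simp
    | mul a x ih =>
      intro h1 h2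
      have hab : b ≠ a := by
        rintro rfl
        exact h1 (dvd_mul_right _ _)
      rw [mul_assoc, letter_dvd_letter_mul hab] at h2
      rw [letter_dvd_letter_mul hab, not_and] at h1
      obtain ⟨h3, h4⟩ := ih (h1 h2.1) h2.2
      exact ⟨(letter_commute h2.1).mul_right h3, h4⟩
  obtain ⟨hc, w, rfl⟩ := key x z hb ⟨y, hz.symm⟩
  refine ⟨hc, w, ?_⟩
  rw [← mul_assoc, ← hc.eq, mul_assoc] at hz
  exact mul_left_cancel hz

/-- Either `x` divides no multiple of `g`, or the divisibility of `g * y` by `x` amounts to the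
divisibility of `y` by a residual of `x`. -/
theorem exists_residual (g x : Trace I) : (∀ y, ¬ x ∣ g * y) ∨
    ∃ x' δ, x = δ * x' ∧ ∀ y, x ∣ g * y ↔ x' ∣ y := by
  induction g using Trace.inductionOn_letter generalizing x with
  | one => exact Or.inr ⟨x, 1, by simp⟩
  | mul b g ih =>
    by_cases hb : letter I b ∣ x
    · obtain ⟨x, rfl⟩ := hb
      simp_rw [mul_assoc, mul_dvd_mul_left_iff']
      refine (ih x).imp id ?_
      rintro ⟨x', δ, rfl, h⟩
      exact ⟨x', letter I b * δ, by rw [mul_assoc], h⟩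
    -- When `b` does not divide `x`, either no multiple of `b` is divisible by `x`, or `x` commutes
    -- with `b` and this letter is irrelevant.
    · by_cases hy : ∃ y, x ∣ letter I b * y
      · obtain ⟨y, hy⟩ := hy
        have hc := (commute_of_dvd_letter_mul hb hy).1
        have : ∀ y, x ∣ letter I b * y ↔ x ∣ y := fun y =>
          ⟨fun h => (commute_of_dvd_letter_mul hb h).2, fun ⟨z, hz⟩ =>
            ⟨letter I b * z, by rw [hz, ← mul_assoc, hc.eq, mul_assoc]⟩⟩
        simp_rw [mul_assoc, this]
        exact ih x
      · push Not at hy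
        exact Or.inl fun y => by rw [mul_assoc]; exact hy _

theorem partialProd_succ' (ξ : ℕ → Clique I) (n : ℕ) :
    partialProd ξ (n + 1) = (ξ 0).toTrace * partialProd (fun i => ξ (i + 1)) n := by
  induction n with
  | zero => simp [partialProd]
  | succ n ih => rw [partialProd, ih, mul_assoc]; rfl

theorem partialProd_dvd {ξ : ℕ → Clique I} {m n : ℕ} (h : m ≤ n) :
    partialProd ξ m ∣ partialProd ξ n := by
  induction n, h using Nat.le_induction with
  | base => exact dvd_rfl
  | succ n _ ih => exact ih.trans (dvd_mul_right _ _)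

/-- The first clique of a normal sequence consists of the letters which divide its product. -/
theorem letter_dvd_partialProd {ξ : ℕ → Clique I} (hξ : ∀ i, (ξ i).Normal (ξ (i + 1))) {a : α}
    (n : ℕ) : letter I a ∣ partialProd ξ (n + 1) ↔ a ∈ (ξ 0).letters := by
  rw [partialProd_succ']
  refine ⟨fun h => ?_, fun h => ((ξ 0).letter_dvd h).trans (dvd_mul_right _ _)⟩
  by_contra ha
  induction n generalizing ξ with
  | zero =>
    obtain ⟨z, hz⟩ := (letter_dvd_clique_mul h ha).2
    have := congrArg Trace.length hz
    simp [partialProd] at this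
    omega
  | succ n ih =>
    obtain ⟨h1, h2⟩ := letter_dvd_clique_mul h ha
    rw [partialProd_succ'] at h2
    -- Here `a` is independent of all of `ξ 0`; normality forbids such a letter in `ξ 1`, so the
    -- argument passes to the shifted sequence.
    by_cases ha' : a ∈ (ξ 1).letters
    · obtain ⟨b, hb, hab⟩ := hξ 0 a ha'
      exact hab (h1 b hb)
    · exact ih (fun i => hξ (i + 1)) h2 ha'

/-- Divisibility by `x` is decided by the first `|x|` cliques. -/
theorem dvd_partialProd_length {ξ : ℕ → Clique I} (hξ : ∀ i, (ξ i).Normal (ξ (i + 1)))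
    {x : Trace I} {n : ℕ} (h : x ∣ partialProd ξ n) : x ∣ partialProd ξ x.length := by
  induction hk : x.length using Nat.strong_induction_on generalizing x ξ n with
  | _ k ih =>
  by_cases hx : x = 1
  · subst hx
    exact one_dvd _
  obtain ⟨a, ha⟩ := exists_letter_dvd hx
  have h' := h.trans (partialProd_dvd n.le_succ)
  have ha' := (letter_dvd_partialProd hξ n).1 (ha.trans h')
  obtain ⟨x, rfl⟩ := ha
  obtain ⟨g, hg⟩ := (ξ 0).letter_dvd ha'
  rw [partialProd_succ', hg, mul_assoc, mul_dvd_mul_left_iff'] at h'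
  -- The letter `a` has been removed from `x`, and `g` is the rest of the first clique. The residual
  -- `x'` is a right factor of what remains, so it is strictly shorter than the original trace: one
  -- clique has been used for at least one unit of length.
  obtain h1 | ⟨x', δ, rfl, h1⟩ := exists_residual g x
  · exact absurd h' (h1 _)
  · simp only [Trace.length_mul, Trace.length_letter] at hk
    obtain ⟨m, rfl⟩ : ∃ m, k = m + 1 := ⟨k - 1, by omega⟩
    rw [h1] at h'
    have h2 := ih x'.length (by omega) (fun i => hξ (i + 1)) h' rfl
    rw [partialProd_succ', hg, mul_assoc, mul_dvd_mul_left_iff', h1]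
    exact h2.trans (partialProd_dvd (by omega))

theorem partialProd_normalForm (x : Trace I) : ∃ n, ∀ k, n ≤ k →
    ((normalForm x).1 k).letters = ∅ ∧ partialProd (normalForm x).1 k = x := by
  obtain ⟨n, h, hp⟩ := (exists_normalForm x).choose_spec
  refine ⟨n, fun k hk => ⟨h k hk, ?_⟩⟩
  change partialProd (exists_normalForm x).choose.1 k = x
  induction k, hk using Nat.le_induction with
  | base => exact hp
  | succ k hk ih =>
    have : (exists_normalForm x).choose.1 k = ⟨∅, by simp⟩ := Clique.ext (h k hk)
    rw [partialProd, ih, this, Clique.toTrace_empty, mul_one]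

end Combinatorics

/-! ### Cylinders in the space of finite and infinite traces: topology and Borel structure -/

section Cylinders

variable {α : Type*} {I : SimpleGraph α}

instance (I : SimpleGraph α) : DiscreteMeasurableSpace (Clique I) := ⟨fun _ => trivial⟩
instance (I : SimpleGraph α) : DiscreteMeasurableSpace (Trace I) := ⟨fun _ => trivial⟩

instance (I : SimpleGraph α) [Countable α] : Countable (Trace I) :=
  have : Countable (FreeMonoid α) := inferInstanceAs (Countable (List α))
  PresentedMonoid.surjective_mk.countable

/-- The generalized traces, finite or infinite, which `x` divides on the left. -/
def genCylinder (x : Trace I) : Set (GenTrace I) := {ξ | ∃ n, x ∣ partialProd ξ.1 n}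

theorem mem_genCylinder_iff {x : Trace I} {ξ : GenTrace I} :
    ξ ∈ genCylinder x ↔ x ∣ partialProd ξ.1 x.length :=
  ⟨fun ⟨_, h⟩ => dvd_partialProd_length ξ.2 h, fun h => ⟨_, h⟩⟩

theorem preimage_genCylinder (x : Trace I) :
    Boundary.toGen ⁻¹' genCylinder x = visualCylinder x := by
  ext ξ
  refine ⟨fun ⟨n, h⟩ => ?_, fun h => h.exists⟩
  exact eventually_atTop.2 ⟨n, fun k hk => h.trans (partialProd_dvd hk)⟩

theorem normalForm_mem_genCylinder {x y : Trace I} : normalForm y ∈ genCylinder x ↔ x ∣ y := by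
  obtain ⟨n, hn⟩ := partialProd_normalForm y
  refine ⟨fun ⟨m, h⟩ => ?_, fun h => ⟨n, by rwa [(hn n le_rfl).2]⟩⟩
  have := h.trans (partialProd_dvd (le_max_right n m))
  rwa [(hn _ (le_max_left n m)).2] at this

theorem isLocallyConstant_partialProd (I : SimpleGraph α) (n : ℕ) :
    IsLocallyConstant fun ξ : GenTrace I => partialProd ξ.1 n := by
  induction n with
  | zero => exact IsLocallyConstant.const 1
  | succ n ih =>
    refine ih.mul (IsLocallyConstant.comp (f := fun ξ : GenTrace I => ξ.1 n) ?_ Clique.toTrace)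
    rw [IsLocallyConstant.iff_continuous]
    exact (continuous_apply n).comp continuous_subtype_val

/-- By `dvd_partialProd_length`, membership depends only on the first `|x|` coordinates, which are
discrete. -/
theorem isClopen_genCylinder (x : Trace I) : IsClopen (genCylinder x) := by
  have h : genCylinder x = (fun ξ : GenTrace I => partialProd ξ.1 x.length) ⁻¹' {y | x ∣ y} := by
    ext ξ
    exact mem_genCylinder_iff
  rw [h]
  exact ⟨⟨isLocallyConstant_partialProd I x.length {y | x ∣ y}ᶜ⟩,
    isLocallyConstant_partialProd I x.length _⟩

theorem partialProd_add (ξ : ℕ → Clique I) (k n : ℕ) :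
    partialProd ξ (k + n) = partialProd ξ k * partialProd (fun i => ξ (k + i)) n := by
  induction n with
  | zero => simp [partialProd]
  | succ n ih => rw [← add_assoc, partialProd, ih, partialProd, mul_assoc]

/-- The tail of `ξ` from index `k` is again normal, so its first clique consists of the letters
dividing it; cancelling the first `k` cliques turns this into a cylinder condition. It serves to
recover coordinates from cylinders. -/
theorem mem_letters_iff (ξ : GenTrace I) (k : ℕ) (a : α) :
    a ∈ (ξ.1 k).letters ↔ ξ ∈ genCylinder (partialProd ξ.1 k * letter I a) := by
  have h := fun n => letter_dvd_partialProd (ξ := fun i => ξ.1 (k + i)) (a := a)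
    (fun i => ξ.2 (k + i)) n
  refine ⟨fun ha => ⟨k + 1, ?_⟩, fun ⟨n, hn⟩ => ?_⟩
  · rw [partialProd_add, mul_dvd_mul_left_iff', h]
    exact ha
  · have := hn.trans (partialProd_dvd (show n ≤ k + (n + 1) by omega))
    rwa [partialProd_add, mul_dvd_mul_left_iff', h] at this

/-- Two cylinders `x` and `g` that meet intersect in the cylinder of `g * x'`, a least common
multiple, where `x'` is the residual of `x` by `g`. -/
theorem isPiSystem_genCylinder (I : SimpleGraph α) :
    IsPiSystem (Set.range (genCylinder (I := I))) := by
  rintro _ ⟨x, rfl⟩ _ ⟨g, rfl⟩ ⟨ξ, ⟨m, hm⟩, n, y, hn⟩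
  have key : ∀ {ξ : GenTrace I}, ξ ∈ genCylinder x ∩ genCylinder g ↔
      ∃ k y, partialProd ξ.1 k = g * y ∧ x ∣ g * y := by
    intro ξ
    constructor
    · rintro ⟨⟨m, hm⟩, n, hn⟩
      obtain ⟨y, hy⟩ := hn.trans (partialProd_dvd (le_max_right m n))
      exact ⟨_, y, hy, hy ▸ hm.trans (partialProd_dvd (le_max_left m n))⟩
    · rintro ⟨k, y, h1, h2⟩
      exact ⟨⟨k, h1 ▸ h2⟩, k, y, h1⟩
  obtain h | ⟨x', δ, -, h⟩ := exists_residual g x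
  · obtain ⟨k, y, -, h'⟩ := key.1 ⟨⟨m, hm⟩, n, y, hn⟩
    exact absurd h' (h y)
  · refine ⟨g * x', ?_⟩
    ext ξ
    rw [key]
    constructor
    · rintro ⟨k, hk⟩
      obtain ⟨y, hy⟩ := (dvd_mul_right g x').trans hk
      exact ⟨k, y, hy, (h y).2 ((mul_dvd_mul_left_iff' g x' y).1 (hy ▸ hk))⟩
    · rintro ⟨k, y, h1, h2⟩
      exact ⟨k, h1 ▸ mul_dvd_mul_left _ ((h y).1 h2)⟩

theorem isClopen_setOf_letters_eq_empty (n : ℕ) :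
    IsClopen {ξ : GenTrace I | (ξ.1 n).letters = ∅} :=
  (isClopen_discrete {γ : Clique I | γ.letters = ∅}).preimage
    ((continuous_apply n).comp continuous_subtype_val)

theorem range_toGen : Set.range (Boundary.toGen (I := I)) =
    ⋂ n, {ξ : GenTrace I | (ξ.1 n).letters = ∅}ᶜ := by
  ext ξ
  simp only [Set.mem_iInter, Set.mem_compl_iff, Set.mem_ofPred_eq, ← Finset.nonempty_iff_ne_empty,
    ← ne_eq]
  exact ⟨fun ⟨η, h⟩ i => h ▸ η.2.1 i, fun h => ⟨⟨ξ.1, h, ξ.2⟩, rfl⟩⟩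

variable [Finite α]

/-- Normality constrains pairs of consecutive coordinates, so it is closed in a product of finite
discrete spaces. -/
instance : CompactSpace (GenTrace I) := by
  have h : IsClosed {ξ : ℕ → Clique I | ∀ i, (ξ i).Normal (ξ (i + 1))} := by
    rw [Set.ofPred_forall]
    refine isClosed_iInter fun i => ?_
    have : Continuous fun ξ : ℕ → Clique I => (ξ i, ξ (i + 1)) := by fun_prop
    exact (isClosed_discrete {p : Clique I × Clique I | p.1.Normal p.2}).preimage this
  exact isCompact_iff_compactSpace.1 h.isCompact

/-- Coordinates are measurable for the cylinder σ-algebra by induction on the index: once the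
product `x` of the first `k` cliques is known, the next clique is read off from the cylinders of `x
* letter I a`, and only countably many `x` occur. -/
theorem generateFrom_genCylinder (I : SimpleGraph α) :
    (inferInstance : MeasurableSpace (GenTrace I)) =
      MeasurableSpace.generateFrom (Set.range genCylinder) := by
  apply le_antisymm
  · set m' := MeasurableSpace.generateFrom (Set.range (genCylinder (I := I)))
    have hcyl : ∀ x : Trace I, MeasurableSet[m'] (genCylinder x) := fun x =>
      MeasurableSpace.measurableSet_generateFrom ⟨x, rfl⟩
    have step : ∀ k, (Measurable[m'] fun ξ : GenTrace I => partialProd ξ.1 k) →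
        Measurable[m'] fun ξ : GenTrace I => ξ.1 k := by
      intro k hk
      refine measurable_to_countable' fun γ => ?_
      have : (fun ξ : GenTrace I => ξ.1 k) ⁻¹' {γ} = ⋃ x : Trace I,
          (fun ξ : GenTrace I => partialProd ξ.1 k) ⁻¹' {x} ∩
            ⋂ a : α, {ξ | a ∈ γ.letters ↔ ξ ∈ genCylinder (x * letter I a)} := by
        ext ξ
        simp only [Set.mem_preimage, Set.mem_singleton_iff, Set.mem_iUnion, Set.mem_inter_iff,
          Set.mem_iInter, Set.mem_ofPred_eq, exists_eq_left', ← mem_letters_iff, Clique.ext_iff,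
          Finset.ext_iff, iff_comm]
      rw [this]
      refine MeasurableSet.iUnion fun x => (hk (measurableSet_singleton x)).inter
        (MeasurableSet.iInter fun a => ?_)
      by_cases ha : a ∈ γ.letters
      · simp only [ha, true_iff]
        exact hcyl _
      · simp only [ha, false_iff]
        exact (hcyl _).compl
    have hprod : ∀ k, Measurable[m'] fun ξ : GenTrace I => partialProd ξ.1 k := by
      intro k
      induction k with
      | zero => exact measurable_const
      | succ k ih =>
        have : Measurable fun p : Trace I × Clique I => p.1 * p.2.toTrace :=
          measurable_of_countable _
        exact this.comp (ih.prodMk (step k ih))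
    have : Measurable[m'] fun ξ : GenTrace I => ξ.1 :=
      measurable_pi_lambda _ fun k => step k (hprod k)
    exact this.comap_le
  · refine MeasurableSpace.generateFrom_le ?_
    rintro _ ⟨x, rfl⟩
    exact (isClopen_genCylinder x).isOpen.measurableSet

theorem ext_of_genCylinder {μ ν : Measure (GenTrace I)} [IsProbabilityMeasure μ]
    [IsProbabilityMeasure ν] (h : ∀ x, μ (genCylinder x) = ν (genCylinder x)) : μ = ν := by
  refine ext_of_generate_finite _ (generateFrom_genCylinder I) (isPiSystem_genCylinder I) ?_
    (by simp)
  rintro _ ⟨x, rfl⟩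
  exact h x

theorem measurableEmbedding_toGen : MeasurableEmbedding (Boundary.toGen (I := I)) := by
  have hm : Measurable (Boundary.toGen (I := I)) := measurable_subtype_coe.subtype_mk
  refine ⟨fun ξ η h => Subtype.ext (Subtype.mk.inj h), hm, ?_⟩
  rintro _ ⟨s, hs, rfl⟩
  have : Boundary.toGen '' (Subtype.val ⁻¹' s) =
      (Subtype.val ⁻¹' s : Set (GenTrace I)) ∩ Set.range (Boundary.toGen (I := I)) := by
    ext ξ
    constructor
    · rintro ⟨η, h, rfl⟩
      exact ⟨h, η, rfl⟩
    · rintro ⟨h, η, rfl⟩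
      exact ⟨η, h, rfl⟩
  rw [this, range_toGen]
  exact (measurable_subtype_coe hs).inter
    (.iInter fun n => (isClopen_setOf_letters_eq_empty n).isOpen.measurableSet.compl)

end Cylinders

/-! ### Möbius inversion and the growth matrix -/

section Mobius

variable {α : Type*} {I : SimpleGraph α} [Finite α]

theorem finite_length_eq (I : SimpleGraph α) (k : ℕ) : {x : Trace I | x.length = k}.Finite := by
  induction k with
  | zero => exact (Set.finite_singleton 1).subset fun x hx => Trace.length_eq_zero.1 hx
  | succ k ih =>
    refine ((Set.finite_univ (α := α)).image2 (fun a x => letter I a * x) ih).subset fun x hx => ?_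
    induction x using Trace.inductionOn_letter with
    | one => simp at hx
    | mul a x _ =>
      refine ⟨a, trivial, x, ?_, rfl⟩
      simp only [Set.mem_ofPred_eq, Trace.length_mul, Trace.length_letter] at hx ⊢
      omega

instance (p : Trace I → Prop) (k : ℕ) : Finite {x : Trace I // p x ∧ x.length = k} :=
  ((finite_length_eq I k).subset fun _ h => h.2 : {x : Trace I | p x ∧ x.length = k}.Finite)

open Classical in
/-- Möbius inversion in the trace monoid. -/
theorem sum_clique_dvd (y : Trace I) :
    ∑ γ : Clique I with γ.toTrace ∣ y, (-1 : ℤ) ^ γ.letters.card = if y = 1 then 1 else 0 := by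
  have := Fintype.ofFinite α
  -- The letters dividing `y` are pairwise independent, so the cliques dividing `y` are exactly the
  -- subsets of `F`. Their alternating sum vanishes unless `F` is empty.
  let F : Finset α := Finset.univ.filter fun a => letter I a ∣ y
  have hF : F = ∅ ↔ y = 1 := by
    refine ⟨fun h => ?_, fun h => ?_⟩
    · by_contra hy
      obtain ⟨a, ha⟩ := exists_letter_dvd hy
      have : a ∈ F := by simp [F, ha]
      simp [h] at this
    · ext a
      simp only [F, Finset.mem_filter_univ, Finset.notMem_empty, iff_false]
      rintro ⟨z, hz⟩
      have := congrArg Trace.length (h.symm.trans hz)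
      simp at this
      omega
  rw [if_congr hF.symm rfl rfl, ← Finset.sum_powerset_neg_one_pow_card]
  refine Finset.sum_bij (fun γ _ => γ.letters) ?_ (fun _ _ _ _ h => Clique.ext h) ?_
    (fun _ _ => rfl)
  · intro γ hγ
    rw [Finset.mem_filter_univ, Clique.toTrace_dvd_iff] at hγ
    simpa [F, Finset.subset_iff] using hγ
  · intro s hs
    have hs' : ∀ a ∈ s, letter I a ∣ y := by simpa [F, Finset.subset_iff] using hs
    refine ⟨⟨s, fun a ha b hb => adj_of_letter_dvd (hs' a ha) (hs' b hb)⟩, ?_, rfl⟩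
    rw [Finset.mem_filter_univ, Clique.toTrace_dvd_iff]
    exact hs'

variable {X : Type*} (S : AsyncSystem I X)

namespace AsyncSystem

omit [Finite α] in
-- Left multiplication by `γ` maps the traces from `s·γ` to `t` bijectively, by cancellation, onto
-- the multiples of `γ` that lead from `s` to `t`; it raises the length by the number of letters of
-- `γ`.
theorem sum_mul_growthEntry_of_clique [Fintype X] [DecidableEq X] (γ : Clique I) (s t : X) (k : ℕ) :
    PowerSeries.coeff k (∑ u, if S.act (some s) γ.toTrace = some u then
      PowerSeries.X ^ γ.letters.card * (S.growthEntry u t).map (Nat.castRingHom ℤ) else 0) =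
    (Nat.card {y : Trace I // (S.act (some s) y = some t ∧ γ.toTrace ∣ y) ∧ y.length = k} : ℤ) := by
  have hact : ∀ x, S.act (some s) (γ.toTrace * x) = S.act (S.act (some s) γ.toTrace) x :=
    S.act_mul _ _
  cases hu : S.act (some s) γ.toTrace with
  | none =>
    have : IsEmpty {y : Trace I // (S.act (some s) y = some t ∧ γ.toTrace ∣ y) ∧ y.length = k} := by
      refine ⟨?_⟩
      rintro ⟨_, ⟨h, x, rfl⟩, -⟩
      rw [hact, hu, S.act_bot] at h
      cases h
    simp
  | some u =>
    simp only [hu] at hact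
    simp only [Option.some_inj, Finset.sum_ite_eq, Finset.mem_univ, if_true]
    rw [PowerSeries.coeff_X_pow_mul']
    split_ifs with hk
    · rw [PowerSeries.coeff_map, growthEntry, PowerSeries.coeff_mk, eq_natCast]
      congr 1
      refine Nat.card_eq_of_bijective (fun x => ⟨γ.toTrace * x.1, ?_⟩) ⟨?_, ?_⟩
      · refine ⟨⟨(hact _).trans x.2.1, dvd_mul_right _ _⟩, ?_⟩
        rw [Trace.length_mul, x.2.2, Clique.length_toTrace]
        omega
      · intro x y h
        exact Subtype.ext (mul_left_cancel (Subtype.mk.inj h))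
      · rintro ⟨_, ⟨h, x, rfl⟩, hx⟩
        rw [Trace.length_mul, Clique.length_toTrace] at hx
        exact ⟨⟨x, (hact x).symm.trans h, by omega⟩, rfl⟩
    · have : IsEmpty {y : Trace I // (S.act (some s) y = some t ∧ γ.toTrace ∣ y) ∧
          y.length = k} := by
        refine ⟨?_⟩
        rintro ⟨_, ⟨h, x, rfl⟩, hx⟩
        rw [Trace.length_mul, Clique.length_toTrace] at hx
        omega
      simp

/-- The growth matrix is the inverse of the Möbius matrix. -/
theorem sum_mobiusMatrix_mul_growthEntry [Fintype X] [DecidableEq X] (s t : X) :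
    ∑ u, (S.mobiusMatrix s u : PowerSeries ℤ) * (S.growthEntry u t).map (Nat.castRingHom ℤ) =
      if s = t then 1 else 0 := by
  classical
  have h1 : ∀ u, (S.mobiusMatrix s u : PowerSeries ℤ) *
      (S.growthEntry u t).map (Nat.castRingHom ℤ) =
      ∑ γ : Clique I, PowerSeries.C ((-1) ^ γ.letters.card) *
        if S.act (some s) γ.toTrace = some u then
        PowerSeries.X ^ γ.letters.card * (S.growthEntry u t).map (Nat.castRingHom ℤ) else 0 := by
    intro u
    rw [mobiusMatrix, Matrix.of_apply, ← Polynomial.coeToPowerSeries.ringHom_apply, map_sum,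
      Finset.sum_mul, Finset.sum_filter]
    refine Finset.sum_congr rfl fun γ _ => ?_
    split_ifs
    · simp [mul_assoc]
    · simp
  simp_rw [h1]
  rw [Finset.sum_comm]
  simp_rw [← Finset.mul_sum]
  ext k
  simp only [map_sum (PowerSeries.coeff k), PowerSeries.coeff_C_mul]
  simp_rw [← map_sum, sum_mul_growthEntry_of_clique]
  let Y : Finset (Trace I) := (finite_length_eq I k).toFinset.filter fun y => S.act (some s) y = some t
  have h2 : ∀ γ : Clique I,
      Nat.card {y : Trace I // (S.act (some s) y = some t ∧ γ.toTrace ∣ y) ∧ y.length = k} =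
        (Y.filter fun y => γ.toTrace ∣ y).card := by
    intro γ
    refine Nat.subtype_card _ fun y => ?_
    simp only [Y, Finset.mem_filter, Set.Finite.mem_toFinset, Set.mem_ofPred_eq]
    tauto
  simp_rw [h2, Finset.card_filter]
  push_cast
  simp_rw [Finset.mul_sum]
  -- With the sum over traces outside, the inner sum over the cliques dividing `y` is the one in
  -- Möbius inversion. Only `y = 1` survives, and it lies in `Y` just when `k = 0` and `s = t`.
  rw [Finset.sum_comm]
  simp_rw [mul_ite, mul_one, mul_zero, ← Finset.sum_filter, sum_clique_dvd]
  rw [Finset.sum_ite_eq']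
  simp only [Y, Finset.mem_filter, Set.Finite.mem_toFinset, Set.mem_ofPred_eq, S.act_one,
    Trace.length_one, Option.some_inj]
  by_cases hst : s = t
  · simp [hst, PowerSeries.coeff_one, eq_comm]
  · simp [hst]

theorem growth_eq_sum [Fintype X] (s : X) : S.growth s = ∑ t, S.growthEntry s t := by
  ext k
  simp only [map_sum, growth, growthEntry, PowerSeries.coeff_mk]
  rw [← Nat.card_sigma]
  refine Nat.card_eq_of_bijective
    (fun x => ⟨(S.act (some s) x.1).get (Option.isSome_iff_ne_none.2 x.2.1), x.1, by simp, x.2.2⟩)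
    ⟨?_, ?_⟩
  · intro x y h
    have := congrArg (fun p : (t : X) × {x : Trace I // S.act (some s) x = some t ∧ x.length = k} =>
      p.2.1) h
    exact Subtype.ext this
  · rintro ⟨t, x, hx, hk⟩
    refine ⟨⟨x, by simp [hx], hk⟩, ?_⟩
    grind

end AsyncSystem

end Mobius

theorem PetriNet.system_act_letter {P T : Type*} (N : PetriNet P T) (s : Option N.State) (t : T) :
    N.system.act s (letter N.indep t) = N.step t s := rfl

/-! ### The net: action, cliques, Möbius matrix and theta polynomial -/

section Example

open Pl Tr

theorem net_indep_iff (t t' : Tr) : net.indep.Adj t t' ↔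
    s(t, t') ∈ ({s(a, d), s(a, e), s(b, d), s(b, e), s(c, e)} : Set (Sym2 Tr)) := by
  have h : net.indep.Adj t t' ↔ ∀ p, p ∈ net.pre t ∪ net.post t → p ∉ net.pre t' ∪ net.post t' :=
    Set.disjoint_left
  have hall : ∀ q : Pl → Prop, (∀ p, q p) ↔ q p₁ ∧ q p₂ ∧ q p₃ ∧ q p₄ := fun q =>
    ⟨fun h => ⟨h _, h _, h _, h _⟩, fun h p => by cases p <;> simp [h]⟩
  rw [h, hall]
  cases t <;> cases t' <;> simp [PetriNet.pre, PetriNet.post, net]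

theorem M₁_apply : M₁.1 = fun p => match p with | p₁ => 0 | p₂ => 1 | p₃ => 1 | p₄ => 1 := by
  funext p
  cases p <;> simp [M₁, PetriNet.fire, PetriNet.pre, PetriNet.post, net]

theorem M₀_ne_M₁ : M₀ ≠ M₁ := by
  intro h
  have := congrFun (congrArg Subtype.val h) p₁
  simp [M₁_apply, M₀, net] at this

theorem eq_M₀_or_eq_M₁ (M : net.State) : M = M₀ ∨ M = M₁ := by
  obtain ⟨l, hl⟩ := M.2
  exact (net_firesTo (Or.inl rfl) hl).imp Subtype.ext Subtype.ext

theorem act_M₀ : net.system.act (some M₀) (letter _ a) = some M₀ ∧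
    net.system.act (some M₀) (letter _ b) = some M₁ ∧
    net.system.act (some M₀) (letter _ c) = none ∧
    net.system.act (some M₀) (letter _ d) = some M₀ ∧
    net.system.act (some M₀) (letter _ e) = some M₀ := by
  have key : ∀ (t : Tr) (h : net.Enabled M₀.1 t), net.fire M₀.1 t = M₀.1 →
      net.step t (some M₀) = some M₀ := fun t h h' => by
    simp only [PetriNet.step, h, dif_pos, Option.some_inj]
    exact Subtype.ext h'
  simp only [PetriNet.system_act_letter]
  refine ⟨key _ ?_ ?_, ?_, ?_, key _ ?_ ?_, key _ ?_ ?_⟩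
  · intro p hp; cases p <;> simp [PetriNet.pre, net, M₀] at hp ⊢
  · funext p; cases p <;> simp [PetriNet.fire, PetriNet.pre, PetriNet.post, net, M₀]
  · exact dif_pos net_enabled_b
  · have : ¬ net.Enabled M₀.1 c := fun h => by
      have := h p₂
      simp [PetriNet.pre, net, M₀] at this
    simp only [PetriNet.step, this, dif_neg, not_false_eq_true]
  · intro p hp; cases p <;> simp [PetriNet.pre, net, M₀] at hp ⊢
  · funext p; cases p <;> simp [PetriNet.fire, PetriNet.pre, PetriNet.post, net, M₀]
  · intro p hp; cases p <;> simp [PetriNet.pre, net, M₀] at hp ⊢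
  · funext p; cases p <;> simp [PetriNet.fire, PetriNet.pre, PetriNet.post, net, M₀]

theorem act_M₁ : net.system.act (some M₁) (letter _ a) = none ∧
    net.system.act (some M₁) (letter _ b) = none ∧
    net.system.act (some M₁) (letter _ c) = some M₀ ∧
    net.system.act (some M₁) (letter _ d) = some M₁ ∧
    net.system.act (some M₁) (letter _ e) = some M₁ := by
  have key : ∀ (t : Tr) (M : net.State), net.Enabled M₁.1 t → net.fire M₁.1 t = M.1 →
      net.step t (some M₁) = some M := fun t M h h' => by
    simp only [PetriNet.step, h, dif_pos, Option.some_inj]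
    exact Subtype.ext h'
  have key' : ∀ t : Tr, p₁ ∈ net.pre t → net.step t (some M₁) = none := fun t h => by
    have : ¬ net.Enabled M₁.1 t := fun h' => by simpa [M₁_apply] using h' p₁ h
    simp only [PetriNet.step, this, dif_neg, not_false_eq_true]
  simp only [PetriNet.system_act_letter]
  refine ⟨key' _ ?_, key' _ ?_, key _ _ ?_ ?_, key _ _ ?_ ?_, key _ _ ?_ ?_⟩
  · simp [PetriNet.pre, net]
  · simp [PetriNet.pre, net]
  · intro p hp; cases p <;> simp [PetriNet.pre, net, M₁_apply] at hp ⊢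
  · funext p; cases p <;> simp [PetriNet.fire, PetriNet.pre, PetriNet.post, net, M₁_apply, M₀]
  · intro p hp; cases p <;> simp [PetriNet.pre, net, M₁_apply] at hp ⊢
  · funext p; cases p <;> simp [PetriNet.fire, PetriNet.pre, PetriNet.post, net, M₁_apply]
  · intro p hp; cases p <;> simp [PetriNet.pre, net, M₁_apply] at hp ⊢
  · funext p; cases p <;> simp [PetriNet.fire, PetriNet.pre, PetriNet.post, net, M₁_apply]

/-- One letter always suffices: `b` and `c` exchange the two markings, and `d` fixes both. -/
theorem net_irreducible : net.system.Irreducible := by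
  intro s t
  have hne : ∀ t : Tr, letter net.indep t ≠ 1 := fun t h => by
    simpa using congrArg Trace.length h
  obtain ⟨-, h01, -, h00, -⟩ := act_M₀
  obtain ⟨-, -, h10, h11, -⟩ := act_M₁
  obtain rfl | rfl := eq_M₀_or_eq_M₁ s <;> obtain rfl | rfl := eq_M₀_or_eq_M₁ t
  exacts [⟨_, hne _, h00⟩, ⟨_, hne _, h01⟩, ⟨_, hne _, h10⟩, ⟨_, hne _, h11⟩]

/-- The sets of pairwise independent transitions. -/
def cliqueSets : Finset (Finset Tr) :=
  {∅, {a}, {b}, {c}, {d}, {e}, {a, d}, {a, e}, {b, d}, {b, e}, {c, e}}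

theorem isClique_iff (s : Finset Tr) : net.indep.IsClique (s : Set Tr) ↔ s ∈ cliqueSets := by
  have h : net.indep.IsClique (s : Set Tr) ↔ ∀ t ∈ s, ∀ t' ∈ s, t ≠ t' → s(t, t') ∈
      ({s(a, d), s(a, e), s(b, d), s(b, e), s(c, e)} : Finset (Sym2 Tr)) := by
    refine forall₂_congr fun t _ => forall₂_congr fun t' _ => imp_congr_right fun _ => ?_
    rw [net_indep_iff]
    simp
  rw [h]
  clear h
  -- Independence is now membership in an explicit finite set, so the equivalence can be checked on
  -- all 32 sets of transitions.
  revert s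
  decide

/-- The clique which consists of one letter. -/
def Clique.single {α : Type*} (I : SimpleGraph α) (t : α) : Clique I := ⟨{t}, by simp⟩

/-- The clique which consists of two independent letters. -/
def Clique.pair {α : Type*} [DecidableEq α] {I : SimpleGraph α} {t t' : α} (h : I.Adj t t') :
    Clique I := ⟨{t, t'}, by simpa [SimpleGraph.isClique_insert] using fun _ => h⟩

@[simp] theorem Clique.toTrace_single {α : Type*} (I : SimpleGraph α) (t : α) :
    (Clique.single I t).toTrace = letter I t :=
  Finset.noncommProd_singleton _ _

@[simp] theorem Clique.toTrace_pair {α : Type*} [DecidableEq α] {I : SimpleGraph α} {t t' : α}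
    (h : I.Adj t t') : (Clique.pair h).toTrace = letter I t * letter I t' := by
  refine (Finset.noncommProd_insert_of_notMem {t'} t _ (Clique.pair h).commute ?_).trans ?_
  · simpa using h.ne
  · rw [Finset.noncommProd_singleton]

theorem sum_clique_eq {R : Type*} [AddCommMonoid R] (f : Clique net.indep → R) :
    ∑ γ, f γ = f ⟨∅, by simp⟩ + (f (.single _ a) + (f (.single _ b) + (f (.single _ c) +
      (f (.single _ d) + (f (.single _ e) +
      (f (.pair ((net_indep_iff a d).2 (by simp))) + (f (.pair ((net_indep_iff a e).2 (by simp))) +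
      (f (.pair ((net_indep_iff b d).2 (by simp))) + (f (.pair ((net_indep_iff b e).2 (by simp))) +
      f (.pair ((net_indep_iff c e).2 (by simp)))))))))))) := by
  classical
  -- Extension of `f` by zero to all sets of transitions, so that the sum can run over the explicit
  -- list of eleven cliques.
  let g : Finset Tr → R := fun s => if h : net.indep.IsClique (s : Set Tr) then f ⟨s, h⟩ else 0
  have hg : ∀ γ, f γ = g γ.letters := fun γ => by simp only [g, dif_pos γ.isClique]
  have : ∑ γ, f γ = ∑ s ∈ cliqueSets, g s :=
    Finset.sum_bij (fun γ _ => γ.letters) (fun γ _ => (isClique_iff _).1 γ.isClique)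
      (fun _ _ _ _ h => Clique.ext h)
      (fun s hs => ⟨⟨s, (isClique_iff s).2 hs⟩, Finset.mem_univ _, rfl⟩) (fun γ _ => hg γ)
  rw [this, cliqueSets]
  iterate 10 rw [Finset.sum_insert (by decide)]
  rw [Finset.sum_singleton]
  simp only [hg]
  rfl

theorem net_mobiusMatrix : net.system.mobiusMatrix M₀ M₀ = 1 - 3 * Polynomial.X + 2 * Polynomial.X ^ 2 ∧
    net.system.mobiusMatrix M₀ M₁ = -Polynomial.X + 2 * Polynomial.X ^ 2 ∧
    net.system.mobiusMatrix M₁ M₀ = -Polynomial.X + Polynomial.X ^ 2 ∧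
    net.system.mobiusMatrix M₁ M₁ = 1 - 2 * Polynomial.X := by
  obtain ⟨h0a, h0b, h0c, h0d, h0e⟩ := act_M₀
  obtain ⟨h1a, h1b, h1c, h1d, h1e⟩ := act_M₁
  have h01 := M₀_ne_M₁
  have h10 := h01.symm
  refine ⟨?_, ?_, ?_, ?_⟩ <;>
  · rw [AsyncSystem.mobiusMatrix, Matrix.of_apply, Finset.sum_filter, sum_clique_eq]
    simp only [Clique.toTrace_single, Clique.toTrace_pair, Clique.toTrace_empty,
      AsyncSystem.act_mul, AsyncSystem.act_one, AsyncSystem.act_bot, h0a, h0b, h0c, h0d, h0e,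
      h1a, h1b, h1c, h1d, h1e, Option.some_inj, h01, h10, reduceCtorEq, if_true, if_false,
      Trace.length_mul, Trace.length_letter, Trace.length_one]
    ring

theorem univ_state [Fintype net.State] [DecidableEq net.State] :
    (Finset.univ : Finset net.State) = {M₀, M₁} := by
  ext M
  simpa using eq_M₀_or_eq_M₁ M

theorem sum_state [Fintype net.State] {R : Type*} [AddCommMonoid R] (f : net.State → R) :
    ∑ M, f M = f M₀ + f M₁ := by
  classical
  rw [univ_state, Finset.sum_pair M₀_ne_M₁]

theorem net_theta : net.system.theta = (1 - Polynomial.X) * (1 - 2 * Polynomial.X) *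
      (1 - 2 * Polynomial.X - Polynomial.X ^ 2) := by
  obtain ⟨f, hf0, hf1⟩ : ∃ f : Fin 2 ≃ net.State, f 0 = M₀ ∧ f 1 = M₁ := by
    refine ⟨Equiv.ofBijective ![M₀, M₁] ⟨fun i j h => ?_, fun M => ?_⟩, rfl, rfl⟩
    · fin_cases i <;> fin_cases j <;> simp [M₀_ne_M₁, M₀_ne_M₁.symm] at h ⊢
    · rcases eq_M₀_or_eq_M₁ M with rfl | rfl
      exacts [⟨0, rfl⟩, ⟨1, rfl⟩]
  obtain ⟨h00, h01, h10, h11⟩ := net_mobiusMatrix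
  -- `theta` uses classical instances; proving the formula for arbitrary ones allows both the
  -- reindexing by `Fin 2` and the final application.
  have key : ∀ (_ : Fintype net.State) (_ : DecidableEq net.State),
      net.system.mobiusMatrix.det = (1 - Polynomial.X) * (1 - 2 * Polynomial.X) *
        (1 - 2 * Polynomial.X - Polynomial.X ^ 2) := by
    intro _ _
    rw [← Matrix.det_submatrix_equiv_self f, Matrix.det_fin_two]
    simp only [Matrix.submatrix_apply, hf0, hf1, h00, h01, h10, h11]
    ring
  exact key _ _

theorem net_isLeast : IsLeast {z : ℝ | 0 < z ∧ Polynomial.aeval z net.system.theta = 0} (√2 - 1) := by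
  have h2 : √2 * √2 = 2 := Real.mul_self_sqrt (by norm_num)
  have h0 := Real.sqrt_nonneg 2
  rw [net_theta]
  simp only [map_mul, map_sub, map_one, Polynomial.aeval_X, map_ofNat, map_pow]
  refine ⟨⟨by nlinarith, by nlinarith⟩, ?_⟩
  rintro z ⟨hz, h⟩
  -- The linear factors vanish at `1` and `1/2`, both above `√2 - 1`; the quadratic one has `√2 - 1`
  -- as its only positive root.
  rcases mul_eq_zero.1 h with h | h
  · rcases mul_eq_zero.1 h with h | h <;> nlinarith
  · nlinarith

end Example

/-! ### Radius of convergence and evaluation of series with natural coefficients -/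

theorem convRadius_eq_of_bounds {f : PowerSeries ℕ} {l c C : ℝ} (hl : 0 < l) (hc : 0 < c)
    (hlow : ∀ k, 1 ≤ k → c * l ^ k ≤ (PowerSeries.coeff k f : ℕ))
    (hup : ∀ k, ((PowerSeries.coeff k f : ℕ) : ℝ) ≤ C * l ^ k) :
    convRadius f = ENNReal.ofReal l⁻¹ := by
  set p := FormalMultilinearSeries.ofScalars ℝ (fun k => ((PowerSeries.coeff k f : ℕ) : ℝ))
  have hp : ∀ k, ‖p k‖ = (PowerSeries.coeff k f : ℕ) := fun k => by
    simp [p]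
  apply le_antisymm
  · refine ENNReal.le_of_forall_nnreal_lt fun r hr => ?_
    -- Terms of a convergent series tend to `0`, but for `r > l⁻¹` they stay above `c` from index
    -- `1` on. Index `0` is left out of the lower bound because the off-diagonal growth entries have
    -- zero constant term.
    have hs := p.summable_norm_mul_pow hr
    rw [← ENNReal.ofReal_coe_nnreal]
    refine ENNReal.ofReal_le_ofReal (le_of_not_gt fun h => ?_)
    have h1 : 1 < l * r := by
      rwa [inv_lt_iff_one_lt_mul₀' hl] at h
    have h2 := hs.tendsto_atTop_zero.eventually_lt_const hc
    obtain ⟨k, hk, hk1⟩ := (h2.and (eventually_ge_atTop 1)).exists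
    rw [hp] at hk
    have h3 : 1 ≤ (l * r) ^ k := one_le_pow₀ h1.le
    have h4 : c * l ^ k * (r : ℝ) ^ k ≤ (PowerSeries.coeff k f : ℕ) * (r : ℝ) ^ k := by
      gcongr
      exact hlow k hk1
    rw [mul_pow] at h3
    nlinarith
  · have hr : ENNReal.ofReal l⁻¹ = ((Real.toNNReal l⁻¹ : NNReal) : ℝ≥0∞) := rfl
    rw [hr]
    refine p.le_radius_of_bound C fun k => ?_
    rw [hp, Real.coe_toNNReal _ (by positivity), inv_pow, ← div_eq_mul_inv,
      div_le_iff₀ (by positivity)]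
    exact hup k

theorem evalSeries_add (f g : PowerSeries ℕ) (q : ℝ) :
    evalSeries (f + g) q = evalSeries f q + evalSeries g q := by
  simp only [evalSeries, map_add, Nat.cast_add, add_mul]
  exact ENNReal.tsum_add

theorem evalSeries_X_mul (f : PowerSeries ℕ) (q : ℝ) :
    evalSeries (PowerSeries.X * f) q = ENNReal.ofReal q * evalSeries f q := by
  rw [evalSeries, tsum_eq_zero_add' ENNReal.summable, evalSeries, ← ENNReal.tsum_mul_left]
  simp only [PowerSeries.coeff_zero_X_mul, PowerSeries.coeff_succ_X_mul, Nat.cast_zero, zero_mul,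
    zero_add, pow_succ]
  exact tsum_congr fun k => by ring

theorem evalSeries_one (q : ℝ) : evalSeries 1 q = 1 := by
  rw [evalSeries, tsum_eq_single 0 (fun k hk => by simp [PowerSeries.coeff_one, hk])]
  simp

theorem evalSeries_lt_top {f : PowerSeries ℕ} {q : ℝ} (h : ENNReal.ofReal q < convRadius f) :
    evalSeries f q < ⊤ := by
  have hs := FormalMultilinearSeries.summable_norm_mul_pow _ h
  simp only [FormalMultilinearSeries.ofScalars_norm, Real.norm_natCast] at hs
  have := hs.tsum_ofReal_lt_top
  refine lt_of_le_of_lt (le_of_eq (tsum_congr fun k => ?_)) this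
  rw [ENNReal.ofReal_mul (by positivity), ENNReal.ofReal_natCast, ENNReal.ofReal_pow (by positivity),
    ENNReal.ofReal_coe_nnreal]
  rfl

/-! ### Growth series of the net and their singularity at `√2 - 1` -/

section Example

/-- The solution of the linear system for the growth matrix, arranged without subtraction. The
identities then hold over `ℕ`, and serve both as recurrences for coefficients and as equations
between sums in `[0, ∞]`. -/
theorem net_growthEntry :
    net.system.growthEntry M₁ M₁ = 1 + PowerSeries.X * (2 * net.system.growthEntry M₁ M₁ +
      PowerSeries.X * net.system.growthEntry M₁ M₁) ∧
    net.system.growthEntry M₀ M₀ = net.system.growthEntry M₁ M₁ +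
      PowerSeries.X * net.system.growthEntry M₀ M₀ ∧
    net.system.growthEntry M₀ M₁ = PowerSeries.X * net.system.growthEntry M₀ M₀ ∧
    net.system.growthEntry M₁ M₀ = PowerSeries.X * (net.system.growthEntry M₁ M₁ +
      2 * net.system.growthEntry M₁ M₀) := by
  classical
  let _ := Fintype.ofFinite net.State
  obtain ⟨h00, h01, h10, h11⟩ := net_mobiusMatrix
  have e := net.system.sum_mobiusMatrix_mul_growthEntry
  simp only [sum_state] at e
  have e00 := e M₀ M₀
  have e01 := e M₀ M₁
  have e10 := e M₁ M₀
  have e11 := e M₁ M₁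
  rw [h00, h01, if_pos rfl] at e00
  rw [h00, h01, if_neg M₀_ne_M₁] at e01
  rw [h10, h11, if_neg M₀_ne_M₁.symm] at e10
  rw [h10, h11, if_pos rfl] at e11
  have two : ((2 : Polynomial ℤ) : PowerSeries ℤ) = 2 := map_ofNat Polynomial.coeToPowerSeries.ringHom 2
  have three : ((3 : Polynomial ℤ) : PowerSeries ℤ) = 3 := map_ofNat Polynomial.coeToPowerSeries.ringHom 3
  simp only [Polynomial.coe_add, Polynomial.coe_sub, Polynomial.coe_mul, Polynomial.coe_neg,
    Polynomial.coe_one, Polynomial.coe_X, Polynomial.coe_pow, two, three] at e00 e01 e10 e11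
  have hinj := PowerSeries.map_injective (Nat.castRingHom ℤ) Nat.cast_injective
  set z : PowerSeries ℤ := PowerSeries.X
  have hz : ∀ m : ℤ, (1 - PowerSeries.C m * z) ≠ 0 := fun m h => by
    simpa [z] using congrArg (PowerSeries.coeff 0) h
  have hz1 : 1 - z ≠ 0 := by simpa using hz 1
  have hz2 : 1 - 2 * z ≠ 0 := hz 2
  have hX : (PowerSeries.X : PowerSeries ℕ).map (Nat.castRingHom ℤ) = z := PowerSeries.map_X _
  have h2 : (2 : PowerSeries ℕ).map (Nat.castRingHom ℤ) = 2 := map_ofNat _ 2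
  set A := (net.system.growthEntry M₀ M₀).map (Nat.castRingHom ℤ) with hA
  set B := (net.system.growthEntry M₀ M₁).map (Nat.castRingHom ℤ) with hB
  set C := (net.system.growthEntry M₁ M₀).map (Nat.castRingHom ℤ) with hC
  set D := (net.system.growthEntry M₁ M₁).map (Nat.castRingHom ℤ) with hD
  -- Both Möbius entries of row `M₀` contain the factor `1 - 2z`: they are `(1 - z)(1 - 2z)` and
  -- `-z(1 - 2z)`. It is nonzero and cancels.
  have hBD : (1 - z) * B = z * D :=
    mul_left_cancel₀ hz2 (by linear_combination e01)
  have hD1 : (1 - 2 * z - z ^ 2) * D = 1 := by linear_combination e11 + z * hBD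
  have hA1 : (1 - 2 * z - z ^ 2) * ((1 - z) * A) = 1 := by linear_combination e00 + z * e10
  have hAD : (1 - z) * A = D := by linear_combination D * hA1 - (1 - z) * A * hD1
  have hBA : B = z * A := mul_left_cancel₀ hz1 (by linear_combination hBD - z * hAD)
  refine ⟨hinj ?_, hinj ?_, hinj ?_, hinj ?_⟩ <;>
    simp only [map_add, map_mul, map_one, hX, h2, ← hA, ← hB, ← hC, ← hD]
  · linear_combination hD1
  · linear_combination hAD
  · exact hBA
  · linear_combination e10 + z * hAD

/-- The coefficients of the entry at `M₁, M₁` obey the Pell recurrence, with dominant root `l = 1 +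
√2 = (√2 - 1)⁻¹`; the other entries inherit this rate. The constant `1/6` absorbs a shift of index,
since `l ≤ 2.5` gives `l/6 ≤ 1/2`. -/
theorem coeff_growthEntry :
    (∀ k, 1 / 2 * (1 + √2) ^ k ≤ (PowerSeries.coeff k (net.system.growthEntry M₁ M₁) : ℕ) ∧
      ((PowerSeries.coeff k (net.system.growthEntry M₁ M₁) : ℕ) : ℝ) ≤ (1 + √2) ^ k) ∧
    (∀ k, 1 / 2 * (1 + √2) ^ k ≤ (PowerSeries.coeff k (net.system.growthEntry M₀ M₀) : ℕ) ∧
      ((PowerSeries.coeff k (net.system.growthEntry M₀ M₀) : ℕ) : ℝ) ≤ 2 * (1 + √2) ^ k) ∧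
    (∀ k, (1 ≤ k → 1 / 6 * (1 + √2) ^ k ≤
        (PowerSeries.coeff k (net.system.growthEntry M₀ M₁) : ℕ)) ∧
      ((PowerSeries.coeff k (net.system.growthEntry M₀ M₁) : ℕ) : ℝ) ≤ 2 * (1 + √2) ^ k) ∧
    (∀ k, (1 ≤ k → 1 / 6 * (1 + √2) ^ k ≤
        (PowerSeries.coeff k (net.system.growthEntry M₁ M₀) : ℕ)) ∧
      ((PowerSeries.coeff k (net.system.growthEntry M₁ M₀) : ℕ) : ℝ) ≤ 3 * (1 + √2) ^ k) := by
  obtain ⟨e11, e00, e01, e10⟩ := net_growthEntry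
  set A := net.system.growthEntry M₀ M₀
  set B := net.system.growthEntry M₀ M₁
  set C := net.system.growthEntry M₁ M₀
  set D := net.system.growthEntry M₁ M₁
  have two : (2 : PowerSeries ℕ) = PowerSeries.C 2 := (map_ofNat _ 2).symm
  have d0 : PowerSeries.coeff 0 D = 1 := by rw [e11]; simp
  have d1 : PowerSeries.coeff 1 D = 2 := by
    rw [e11, map_add, PowerSeries.coeff_succ_X_mul, map_add, PowerSeries.coeff_zero_X_mul, two,
      PowerSeries.coeff_C_mul, d0]
    simp [PowerSeries.coeff_one]
  have d2 : ∀ k, PowerSeries.coeff (k + 2) D =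
      2 * PowerSeries.coeff (k + 1) D + PowerSeries.coeff k D := by
    intro k
    conv_lhs => rw [e11]
    rw [map_add, PowerSeries.coeff_succ_X_mul, map_add, PowerSeries.coeff_succ_X_mul, two,
      PowerSeries.coeff_C_mul]
    simp [PowerSeries.coeff_one]
  have a0 : PowerSeries.coeff 0 A = 1 := by rw [e00, map_add, d0, PowerSeries.coeff_zero_X_mul, add_zero]
  have a1 : ∀ k, PowerSeries.coeff (k + 1) A =
      PowerSeries.coeff (k + 1) D + PowerSeries.coeff k A := by
    intro k
    conv_lhs => rw [e00]
    rw [map_add, PowerSeries.coeff_succ_X_mul]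
  have b0 : PowerSeries.coeff 0 B = 0 := by rw [e01]; simp
  have b1 : ∀ k, PowerSeries.coeff (k + 1) B = PowerSeries.coeff k A := fun k => by
    rw [e01, PowerSeries.coeff_succ_X_mul]
  have c0 : PowerSeries.coeff 0 C = 0 := by rw [e10]; simp
  have c1 : ∀ k, PowerSeries.coeff (k + 1) C =
      PowerSeries.coeff k D + 2 * PowerSeries.coeff k C := by
    intro k
    conv_lhs => rw [e10]
    rw [PowerSeries.coeff_succ_X_mul, map_add, two, PowerSeries.coeff_C_mul]
  have hs : √2 * √2 = 2 := Real.mul_self_sqrt (by norm_num)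
  have hs0 := Real.sqrt_nonneg 2
  have hs1 : 1.4 ≤ √2 := by nlinarith
  have hs2 : √2 ≤ 1.5 := by nlinarith
  set l := 1 + √2
  have hl : l ^ 2 = 2 * l + 1 := by simp only [l]; linear_combination hs
  have hl1 : 2.4 ≤ l := by simp only [l]; linarith
  have hl2 : l ≤ 2.5 := by simp only [l]; linarith
  have hpos : ∀ k : ℕ, 0 < l ^ k := fun k => by positivity
  have hD : ∀ k, 1 / 2 * l ^ k ≤ (PowerSeries.coeff k D : ℕ) ∧
      ((PowerSeries.coeff k D : ℕ) : ℝ) ≤ l ^ k := by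
    intro k
    induction k using Nat.strong_induction_on with
    | _ k ih =>
    match k with
    | 0 => norm_num [d0]
    | 1 => rw [d1]; norm_num; constructor <;> linarith
    | k + 2 =>
      have h1 := ih k (by omega)
      have h2 := ih (k + 1) (by omega)
      rw [d2, pow_add, hl]
      rw [pow_succ] at h2
      push_cast
      constructor <;> linarith [h1.1, h1.2, h2.1, h2.2]
  have hA : ∀ k, 1 / 2 * l ^ k ≤ (PowerSeries.coeff k A : ℕ) ∧
      ((PowerSeries.coeff k A : ℕ) : ℝ) ≤ 2 * l ^ k := by
    intro k
    induction k with
    | zero => norm_num [a0]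
    | succ k ih =>
      have h := hD (k + 1)
      have h0 := hpos k
      rw [a1]
      push_cast
      rw [pow_succ] at h ⊢
      constructor <;> nlinarith
  refine ⟨hD, hA, fun k => ?_, fun k => ?_⟩
  · cases k with
    | zero => norm_num [b0]
    | succ k =>
      have h := hA k
      have h0 := hpos k
      rw [b1, pow_succ]
      exact ⟨fun _ => by nlinarith, by nlinarith⟩
  -- The constant `3` is preserved by `c_{k+1} = d_k + 2 c_k` because `1 + 2 * 3 ≤ 3 * l`, which
  -- holds as `l ≥ 2.4`.
  · have hC : ∀ k, ((PowerSeries.coeff k C : ℕ) : ℝ) ≤ 3 * l ^ k := by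
      intro k
      induction k with
      | zero => norm_num [c0]
      | succ k ih =>
        have h := hD k
        have h0 := hpos k
        rw [c1, pow_succ]
        push_cast
        nlinarith
    refine ⟨fun hk => ?_, hC k⟩
    obtain ⟨k, rfl⟩ : ∃ m, k = m + 1 := ⟨k - 1, by omega⟩
    have h := hD k
    have h0 := hpos k
    have h1 : (0 : ℝ) ≤ (PowerSeries.coeff k C : ℕ) := Nat.cast_nonneg _
    rw [c1, pow_succ]
    push_cast
    nlinarith

theorem net_growth :
    net.system.growth M₀ = net.system.growthEntry M₀ M₀ + net.system.growthEntry M₀ M₁ ∧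
    net.system.growth M₁ = net.system.growthEntry M₁ M₀ + net.system.growthEntry M₁ M₁ := by
  let _ := Fintype.ofFinite net.State
  constructor <;> rw [AsyncSystem.growth_eq_sum, sum_state]

theorem inv_one_add_sqrt_two : (1 + √2)⁻¹ = √2 - 1 := by
  have hs : √2 * √2 = 2 := Real.mul_self_sqrt (by norm_num)
  refine inv_eq_of_mul_eq_one_right ?_
  linear_combination hs

theorem net_isCharacteristicRoot : net.system.IsCharacteristicRoot (√2 - 1) := by
  have hs : √2 * √2 = 2 := Real.mul_self_sqrt (by norm_num)
  have hs0 := Real.sqrt_nonneg 2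
  have hl : 0 < 1 + √2 := by positivity
  obtain ⟨hD, hA, hB, hC⟩ := coeff_growthEntry
  refine ⟨⟨by nlinarith, by nlinarith⟩, fun s t => ?_, fun s => ?_⟩
  · rw [← inv_one_add_sqrt_two]
    rcases eq_M₀_or_eq_M₁ s with rfl | rfl <;> rcases eq_M₀_or_eq_M₁ t with rfl | rfl
    · exact convRadius_eq_of_bounds hl (by norm_num) (fun k _ => (hA k).1) fun k => (hA k).2
    · exact convRadius_eq_of_bounds hl (by norm_num) (fun k => (hB k).1) fun k => (hB k).2
    · exact convRadius_eq_of_bounds hl (by norm_num) (fun k => (hC k).1) fun k => (hC k).2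
    · refine convRadius_eq_of_bounds (C := 1) hl (c := 1 / 2) (by norm_num) (fun k _ => (hD k).1)
        fun k => by simpa using (hD k).2
  · rw [← inv_one_add_sqrt_two]
    rcases eq_M₀_or_eq_M₁ s with rfl | rfl
    · refine convRadius_eq_of_bounds (c := 1 / 2) (C := 4) hl (by norm_num) (fun k _ => ?_)
        fun k => ?_ <;> rw [net_growth.1, map_add, Nat.cast_add]
      · exact (hA k).1.trans (le_add_of_nonneg_right (Nat.cast_nonneg _))
      · linarith [(hA k).2, (hB k).2]
    · refine convRadius_eq_of_bounds (c := 1 / 2) (C := 4) hl (by norm_num) (fun k _ => ?_)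
        fun k => ?_ <;> rw [net_growth.2, map_add, Nat.cast_add]
      · exact (hD k).1.trans (le_add_of_nonneg_left (Nat.cast_nonneg _))
      · linarith [(hC k).2, (hD k).2]

theorem eq_of_isCharacteristicRoot {q₀ : ℝ} (h : net.system.IsCharacteristicRoot q₀) :
    q₀ = √2 - 1 := by
  have h' := net_isCharacteristicRoot
  have := (h.2.2 M₀).symm.trans (h'.2.2 M₀)
  rwa [ENNReal.ofReal_eq_ofReal_iff h.1.1.le h'.1.1.le] at this

theorem evalSeries_growth_lt_top {q : ℝ} (hq : q < √2 - 1) (s : net.State) :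
    evalSeries (net.system.growth s) q < ⊤ := by
  refine evalSeries_lt_top ?_
  rw [net_isCharacteristicRoot.2.2 s]
  exact (ENNReal.ofReal_lt_ofReal_iff net_isCharacteristicRoot.1.1).2 hq

/-- Below the characteristic root all the sums are finite, so the subtraction-free identities become
real linear equations that can be solved. -/
theorem toReal_evalSeries_growth {q : ℝ} (h0 : 0 < q) (hq : q < √2 - 1) :
    (evalSeries (net.system.growth M₀) q).toReal = (1 + q) / ((1 - q) * (1 - 2 * q - q ^ 2)) ∧
    (evalSeries (net.system.growth M₁) q).toReal = (1 - q) / ((1 - 2 * q) * (1 - 2 * q - q ^ 2)) := by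
  obtain ⟨e11, e00, e01, e10⟩ := net_growthEntry
  have hfin : ∀ s t, evalSeries (net.system.growthEntry s t) q ≠ ⊤ := fun s t => by
    refine (evalSeries_lt_top ?_).ne
    rw [net_isCharacteristicRoot.2.1 s]
    exact (ENNReal.ofReal_lt_ofReal_iff net_isCharacteristicRoot.1.1).2 hq
  have fA := hfin M₀ M₀
  have fB := hfin M₀ M₁
  have fC := hfin M₁ M₀
  have fD := hfin M₁ M₁
  rw [net_growth.1, net_growth.2, evalSeries_add, evalSeries_add, ENNReal.toReal_add fA fB,
    ENNReal.toReal_add fC fD]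
  replace e11 := congrArg (evalSeries · q) e11
  replace e00 := congrArg (evalSeries · q) e00
  replace e01 := congrArg (evalSeries · q) e01
  replace e10 := congrArg (evalSeries · q) e10
  simp only [two_mul, evalSeries_add, evalSeries_X_mul, evalSeries_one] at e11 e00 e01 e10
  lift q to NNReal using h0.le
  simp only [ENNReal.ofReal_coe_nnreal] at e11 e00 e01 e10
  generalize evalSeries (net.system.growthEntry M₀ M₀) q = A at *
  generalize evalSeries (net.system.growthEntry M₀ M₁) q = B at *
  generalize evalSeries (net.system.growthEntry M₁ M₀) q = C at *
  generalize evalSeries (net.system.growthEntry M₁ M₁) q = D at *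
  lift A to NNReal using fA
  lift B to NNReal using fB
  lift C to NNReal using fC
  lift D to NNReal using fD
  norm_cast at e11 e00 e01 e10
  rw [← NNReal.coe_inj] at e11 e00 e01 e10
  push_cast at e11 e00 e01 e10
  simp only [ENNReal.coe_toReal]
  have hs : √2 * √2 = 2 := Real.mul_self_sqrt (by norm_num)
  have hs2 : √2 ≤ 1.5 := by nlinarith [Real.sqrt_nonneg 2]
  have p1 : (0 : ℝ) < 1 - q := by linarith
  have p2 : (0 : ℝ) < 1 - 2 * q := by linarith
  have p3 : (0 : ℝ) < 1 - 2 * q - q ^ 2 := by nlinarith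
  constructor
  · rw [eq_div_iff (by positivity)]
    linear_combination (1 - q) * (1 - 2 * q - q ^ 2) * e01 + (1 + q) * (1 - 2 * q - q ^ 2) * e00 +
      (1 + q) * e11
  · rw [eq_div_iff (by positivity)]
    linear_combination (1 - 2 * q - q ^ 2) * e10 + (1 - q) * e11

/-- Each closed form is at least `1/(1 - 2q - q^2)`, the remaining factors `(1 + q)/(1 - q)` and `(1
- q)/(1 - 2q)` being at least `1`. -/
theorem tendsto_evalSeries_growth (s : net.State) :
    Tendsto (fun q => (evalSeries (net.system.growth s) q).toReal) (𝓝[<] (√2 - 1)) atTop := by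
  have hs : √2 * √2 = 2 := Real.mul_self_sqrt (by norm_num)
  have hs1 : 1.4 ≤ √2 := by nlinarith [Real.sqrt_nonneg 2]
  have hs2 : √2 ≤ 1.5 := by nlinarith [Real.sqrt_nonneg 2]
  have hev : ∀ᶠ q : ℝ in 𝓝[<] (√2 - 1), q ∈ Set.Ioo 0 (√2 - 1) :=
    Ioo_mem_nhdsLT (by linarith)
  have hden : Tendsto (fun q : ℝ => (1 - 2 * q - q ^ 2)⁻¹) (𝓝[<] (√2 - 1)) atTop := by
    refine Tendsto.inv_tendsto_nhdsGT_zero (tendsto_nhdsWithin_iff.2 ⟨?_, ?_⟩)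
    · have : Continuous fun q : ℝ => 1 - 2 * q - q ^ 2 := by fun_prop
      have h := (this.tendsto (√2 - 1)).mono_left (nhdsWithin_le_nhds (s := Set.Iio (√2 - 1)))
      have h0 : 1 - 2 * (√2 - 1) - (√2 - 1) ^ 2 = 0 := by linear_combination -hs
      rwa [h0] at h
    · filter_upwards [hev] with q hq
      have := hq.1
      have := hq.2
      simp only [Set.mem_Ioi]
      nlinarith
  rcases eq_M₀_or_eq_M₁ s with rfl | rfl
  · refine tendsto_atTop_mono' _ ?_ hden
    filter_upwards [hev] with q hq
    have h1 := hq.1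
    have h2 := hq.2
    have p3 : (0 : ℝ) < 1 - 2 * q - q ^ 2 := by nlinarith
    rw [(toReal_evalSeries_growth h1 h2).1, ← one_div, div_le_div_iff₀ p3
      (mul_pos (by linarith) p3)]
    nlinarith
  · refine tendsto_atTop_mono' _ ?_ hden
    filter_upwards [hev] with q hq
    have h1 := hq.1
    have h2 := hq.2
    have p3 : (0 : ℝ) < 1 - 2 * q - q ^ 2 := by nlinarith
    rw [(toReal_evalSeries_growth h1 h2).2, ← one_div, div_le_div_iff₀ p3
      (mul_pos (by linarith) p3)]
    nlinarith

/-- The singular factor cancels in the ratio, which equals `(1 - q)^2 / ((1 - 2q)(1 + q))` and is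
continuous at `√2 - 1`. -/
theorem tendsto_evalSeries_growth_div :
    Tendsto (fun q => (evalSeries (net.system.growth M₁) q).toReal /
      (evalSeries (net.system.growth M₀) q).toReal) (𝓝[<] (√2 - 1)) (𝓝 √2) := by
  have hs : √2 * √2 = 2 := Real.mul_self_sqrt (by norm_num)
  have hs1 : 1.4 ≤ √2 := by nlinarith [Real.sqrt_nonneg 2]
  have hs2 : √2 < 1.5 := by nlinarith [Real.sqrt_nonneg 2]
  have hc : ContinuousAt (fun q : ℝ => (1 - q) ^ 2 / ((1 - 2 * q) * (1 + q))) (√2 - 1) := by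
    refine ContinuousAt.div (by fun_prop) (by fun_prop) (mul_pos ?_ ?_).ne' <;> linarith
  have h := hc.tendsto.mono_left (nhdsWithin_le_nhds (s := Set.Iio (√2 - 1)))
  have h0 : (1 - (√2 - 1)) ^ 2 / ((1 - 2 * (√2 - 1)) * (1 + (√2 - 1))) = √2 := by
    rw [div_eq_iff (mul_pos (by linarith) (by linarith)).ne']
    linear_combination (2 * √2 - 2) * hs
  rw [h0] at h
  refine h.congr' ?_
  filter_upwards [Ioo_mem_nhdsLT (show 0 < √2 - 1 by linarith)] with q hq
  have h1 := hq.1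
  have h2 := hq.2
  have p1 : 0 < 1 - q := by linarith
  have p2 : 0 < 1 - 2 * q := by linarith
  have p3 : 0 < 1 - 2 * q - q ^ 2 := by nlinarith
  have p4 : 0 < 1 + q := by linarith
  rw [(toReal_evalSeries_growth h1 h2).1, (toReal_evalSeries_growth h1 h2).2,
    div_div_div_eq, div_eq_div_iff (by positivity) (by positivity)]
  ring

end Example

/-! ### Weak convergence of the discrete measures to the boundary -/

section Measures

variable {α : Type*} {I : SimpleGraph α} [Finite α]

instance : TopologicalSpace.MetrizableSpace (GenTrace I) :=
  have : TopologicalSpace.MetrizableSpace (Clique I) :=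
    TopologicalSpace.metrizableSpace_of_t3_secondCountable _
  Topology.IsEmbedding.subtypeVal.metrizableSpace

/-- A family of probability measures whose values on the cylinders converge is weakly
convergent. -/
theorem exists_tendsto_of_tendsto_genCylinder {ι : Type*} {F : Filter ι} [F.NeBot]
    (u : ι → ProbabilityMeasure (GenTrace I)) (L : Trace I → ℝ≥0∞)
    (h : ∀ x, Tendsto (fun i => (u i : Measure (GenTrace I)) (genCylinder x)) F (𝓝 (L x))) :
    ∃ ν : ProbabilityMeasure (GenTrace I), Tendsto u F (𝓝 ν) ∧
      ∀ x, (ν : Measure (GenTrace I)) (genCylinder x) = L x := by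
  -- Cylinders are clopen, so their frontier is null and their mass passes to weak limits along
  -- ultrafilters. All cluster points thus agree on cylinders; compactness of the space of
  -- probability measures provides one.
  have key : ∀ ν : ProbabilityMeasure (GenTrace I), ClusterPt ν (map u F) →
      ∀ x, (ν : Measure (GenTrace I)) (genCylinder x) = L x := by
    intro ν hν x
    obtain ⟨U, hU, hν⟩ := mapClusterPt_iff_ultrafilter.1 hν
    refine tendsto_nhds_unique ?_ ((h x).mono_left hU)
    refine ProbabilityMeasure.tendsto_measure_of_null_frontier_of_tendsto' hν ?_
    rw [(isClopen_genCylinder x).frontier_eq, measure_empty]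
  obtain ⟨ν, hν⟩ := exists_clusterPt_of_compactSpace (map u F)
  refine ⟨ν, le_nhds_of_unique_clusterPt fun ν' hν' => ?_, key ν hν⟩
  have h : (ν' : Measure (GenTrace I)) = ν :=
    ext_of_genCylinder fun x => (key ν' hν' x).trans (key ν hν x).symm
  exact Subtype.ext h

/-- By normality only the empty clique can follow an empty one, so such a trace is the product of
its first `n` cliques, and there are finitely many choices for these. -/
theorem finite_letters_normalForm_eq_empty (I : SimpleGraph α) (n : ℕ) :
    {x : Trace I | ((normalForm x).1 n).letters = ∅}.Finite := by
  have h1 : ∀ x : Trace I, ((normalForm x).1 n).letters = ∅ →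
      ∀ k, n ≤ k → ((normalForm x).1 k).letters = ∅ := by
    intro x hx k hk
    induction k, hk using Nat.le_induction with
    | base => exact hx
    | succ k _ ih =>
      refine Finset.eq_empty_of_forall_notMem fun b hb => ?_
      obtain ⟨a, ha, -⟩ := (normalForm x).2 k b hb
      simp [ih] at ha
  have h2 : ∀ x : Trace I, ((normalForm x).1 n).letters = ∅ →
      partialProd (normalForm x).1 n = x := by
    intro x hx
    obtain ⟨m, hm⟩ := partialProd_normalForm x
    have : ∀ k, n ≤ k → partialProd (normalForm x).1 k = partialProd (normalForm x).1 n := by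
      intro k hk
      induction k, hk using Nat.le_induction with
      | base => rfl
      | succ k hk ih =>
        have e : (normalForm x).1 k = ⟨∅, by simp⟩ := Clique.ext (h1 x hx k hk)
        rw [partialProd, ih, e, Clique.toTrace_empty, mul_one]
    rw [← this _ (le_max_left n m), (hm _ (le_max_right n m)).2]
  have h3 : (Set.range fun g : Fin n → Clique I =>
      partialProd (fun i => if h : i < n then g ⟨i, h⟩ else ⟨∅, by simp⟩) n).Finite :=
    Set.finite_range _
  refine h3.subset fun x hx => ⟨fun i => (normalForm x).1 i, ?_⟩
  refine Eq.trans ?_ (h2 x hx)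
  have : ∀ ξ η : ℕ → Clique I, ∀ k, (∀ i, i < k → ξ i = η i) →
      partialProd ξ k = partialProd η k := by
    intro ξ η k
    induction k with
    | zero => intro _; rfl
    | succ k ih =>
      intro h
      rw [partialProd, partialProd, ih fun i hi => h i (by omega), h k (by omega)]
  exact this _ _ n fun i hi => by simp [hi]

variable {X : Type*} (S : AsyncSystem I X)

namespace AsyncSystem

theorem evalSeries_growth (s : X) (q : ℝ) : evalSeries (S.growth s) q =
    ∑' x : {x : Trace I // S.act (some s) x ≠ none}, ENNReal.ofReal q ^ x.1.length := by
  rw [← (Equiv.sigmaFiberEquiv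
    fun x : {x : Trace I // S.act (some s) x ≠ none} => x.1.length).tsum_eq,
    ENNReal.tsum_sigma', evalSeries]
  refine tsum_congr fun k => ?_
  have h : ∀ x : {x : {x : Trace I // S.act (some s) x ≠ none} // x.1.length = k},
      ENNReal.ofReal q ^ (Equiv.sigmaFiberEquiv
        (fun x : {x : Trace I // S.act (some s) x ≠ none} => x.1.length) ⟨k, x⟩).1.length =
      ENNReal.ofReal q ^ k := fun x => congrArg _ x.2
  rw [tsum_congr h]
  let e := Equiv.subtypeSubtypeEquivSubtypeInter (fun x : Trace I => S.act (some s) x ≠ none)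
    (fun x => x.length = k)
  have : Finite {x : {x : Trace I // S.act (some s) x ≠ none} // x.1.length = k} :=
    Finite.of_equiv _ e.symm
  have := Fintype.ofFinite {x : {x : Trace I // S.act (some s) x ≠ none} // x.1.length = k}
  rw [tsum_fintype, Finset.sum_const, nsmul_eq_mul, growth, PowerSeries.coeff_mk,
    ← Nat.card_congr e, Nat.card_eq_fintype_card]
  rfl

theorem discreteMeasure_apply (s : X) (q : ℝ) (A : Set (Trace I)) :
    S.discreteMeasure s q A = (evalSeries (S.growth s) q)⁻¹ *
      ∑' x : {x : Trace I // S.act (some s) x ≠ none},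
        ENNReal.ofReal q ^ x.1.length * A.indicator 1 x.1 := by
  rw [discreteMeasure, Measure.smul_apply, Measure.sum_apply _ (.of_discrete), smul_eq_mul]
  congr 1
  refine tsum_congr fun x => ?_
  rw [Measure.smul_apply, Measure.dirac_apply, smul_eq_mul]

theorem isProbabilityMeasure_discreteMeasure {s : X} {q : ℝ} (h0 : evalSeries (S.growth s) q ≠ 0)
    (h1 : evalSeries (S.growth s) q ≠ ⊤) : IsProbabilityMeasure (S.discreteMeasure s q) := by
  refine ⟨?_⟩
  rw [discreteMeasure_apply]
  simp only [Set.indicator_univ, Pi.one_apply, mul_one]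
  rw [← evalSeries_growth, ENNReal.inv_mul_cancel h0 h1]

/-- The multiples of `x` with nonzero weight are the `x * z` with `z` acting from `t`, each obtained
once by cancellation; `q^|x|` factors out of the weights. -/
theorem discreteMeasure_dvd_of_eq_some {s t : X} {x : Trace I} (h : S.act (some s) x = some t)
    (q : ℝ) : S.discreteMeasure s q {y | x ∣ y} = ENNReal.ofReal q ^ x.length *
      (evalSeries (S.growth t) q * (evalSeries (S.growth s) q)⁻¹) := by
  have hact : ∀ z, S.act (some s) (x * z) = S.act (some t) z := fun z => by rw [S.act_mul, h]
  rw [discreteMeasure_apply, S.evalSeries_growth t]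
  let g : {z : Trace I // S.act (some t) z ≠ none} → {y : Trace I // S.act (some s) y ≠ none} :=
    fun z => ⟨x * z.1, (hact z.1).trans_ne z.2⟩
  have hg : Function.Injective g := fun z z' h =>
    Subtype.ext (mul_left_cancel (Subtype.mk.inj h))
  rw [← hg.tsum_eq]
  · simp only [g, Trace.length_mul, pow_add, mul_assoc]
    rw [ENNReal.tsum_mul_left]
    have : ∀ z, Set.indicator {y | x ∣ y} (1 : Trace I → ℝ≥0∞) (x * z) = 1 := fun z =>
      Set.indicator_of_mem (s := {y | x ∣ y}) (dvd_mul_right x z) _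
    simp only [this, mul_one]
    ring
  · rintro ⟨y, hy⟩ hy'
    have : y ∈ {y | x ∣ y} := by
      by_contra hn
      rw [Function.mem_support, Set.indicator_of_notMem hn, mul_zero] at hy'
      exact hy' rfl
    obtain ⟨z, rfl⟩ := this
    exact ⟨⟨z, (hact z).symm.trans_ne hy⟩, rfl⟩

theorem discreteMeasure_dvd_of_eq_none {s : X} {x : Trace I} (h : S.act (some s) x = none)
    (q : ℝ) : S.discreteMeasure s q {y | x ∣ y} = 0 := by
  rw [discreteMeasure_apply, ENNReal.tsum_eq_zero.2, mul_zero]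
  rintro ⟨y, hy⟩
  rw [Set.indicator_of_notMem, mul_zero]
  rintro ⟨z, rfl⟩
  exact hy (by rw [S.act_mul, h, S.act_bot])

theorem discreteMeasure_le_of_finite {s : X} {q : ℝ} (hq : q ≤ 1) {A : Set (Trace I)}
    (hA : A.Finite) :
    S.discreteMeasure s q A ≤ (evalSeries (S.growth s) q)⁻¹ * hA.toFinset.card := by
  classical
  rw [discreteMeasure_apply]
  gcongr
  calc ∑' x : {x : Trace I // S.act (some s) x ≠ none},
        ENNReal.ofReal q ^ x.1.length * A.indicator 1 x.1
      ≤ ∑' x : {x : Trace I // S.act (some s) x ≠ none}, A.indicator 1 x.1 :=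
        ENNReal.tsum_le_tsum fun x => mul_le_of_le_one_left' (pow_le_one₀ zero_le
          (ENNReal.ofReal_le_one.2 hq))
    _ ≤ ∑' x : Trace I, A.indicator 1 x :=
        ENNReal.tsum_comp_le_tsum_of_injective Subtype.val_injective _
    _ = hA.toFinset.card := by
        rw [tsum_eq_sum (s := hA.toFinset) fun x hx => Set.indicator_of_notMem (by simpa using hx) _,
          Finset.sum_congr rfl fun x hx => Set.indicator_of_mem (by simpa using hx) _]
        simp

/-- If the masses of the cylinders converge and the growth series diverges at `q₀`, then the
measures `m_{s,q}` converge weakly to a probability measure on the boundary. -/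
theorem exists_tendsto_discreteMeasure {s : X} {q₀ : ℝ} (hq₀ : q₀ ≤ 1)
    (hfin : ∀ q < q₀, evalSeries (S.growth s) q ≠ ⊤)
    (htop : Tendsto (fun q => evalSeries (S.growth s) q) (𝓝[<] q₀) (𝓝 ⊤)) {L : Trace I → ℝ≥0∞}
    (hL : ∀ x, Tendsto (fun q => S.discreteMeasure s q {y | x ∣ y}) (𝓝[<] q₀) (𝓝 (L x))) :
    ∃ ν : ProbabilityMeasure (Boundary I),
      (∀ f : GenTrace I →ᵇ ℝ,
        Tendsto (fun q : ℝ => ∫ x, f (normalForm x) ∂(S.discreteMeasure s q)) (𝓝[<] q₀)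
          (𝓝 (∫ ξ, f ξ.toGen ∂(ν : Measure (Boundary I))))) ∧
      ∀ x, (ν : Measure (Boundary I)) (visualCylinder x) = L x := by
  have hmeas : Measurable (normalForm (I := I)) := measurable_from_top
  have hev : ∀ᶠ q in 𝓝[<] q₀, IsProbabilityMeasure (S.discreteMeasure s q) := by
    filter_upwards [self_mem_nhdsWithin, htop.eventually_ne ENNReal.top_ne_zero] with q hq h0
    exact S.isProbabilityMeasure_discreteMeasure h0 (hfin q hq)
  -- The discrete measure is known to be a probability only for `q` close to `q₀` from below;
  -- elsewhere a Dirac mass is a filler that does not affect the limit.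
  have hex : ∀ q, ∃ P : ProbabilityMeasure (GenTrace I),
      IsProbabilityMeasure (S.discreteMeasure s q) →
        (P : Measure (GenTrace I)) = (S.discreteMeasure s q).map normalForm := by
    intro q
    by_cases h : IsProbabilityMeasure (S.discreteMeasure s q)
    · exact ⟨⟨_, Measure.isProbabilityMeasure_map hmeas.aemeasurable⟩, fun _ => rfl⟩
    · exact ⟨⟨Measure.dirac (normalForm 1), inferInstance⟩, fun h' => absurd h' h⟩
  choose u hu using hex
  replace hu := hev.mono hu
  obtain ⟨μ, hμ, hμL⟩ := exists_tendsto_of_tendsto_genCylinder u L fun x => by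
    refine (hL x).congr' ?_
    filter_upwards [hu] with q hq
    rw [hq, Measure.map_apply hmeas (isClopen_genCylinder x).isOpen.measurableSet]
    congr 1
    ext y
    exact normalForm_mem_genCylinder.symm
  -- Only finitely many finite traces have an empty `n`-th clique, and each has weight at most `1`
  -- before division by `G_s(q)`. Their mass tends to `0`, also for the limit as the set is clopen;
  -- so `μ` is carried by the boundary.
  have hnull : ∀ n, (μ : Measure (GenTrace I)) {ξ | (ξ.1 n).letters = ∅} = 0 := by
    intro n
    have hcl := isClopen_setOf_letters_eq_empty (I := I) n
    have hT := finite_letters_normalForm_eq_empty I n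
    have h1 := ProbabilityMeasure.tendsto_measure_of_null_frontier_of_tendsto' hμ
      (E := {ξ | (ξ.1 n).letters = ∅}) (by rw [hcl.frontier_eq, measure_empty])
    refine tendsto_nhds_unique h1 ?_
    have h2 : Tendsto (fun q => (evalSeries (S.growth s) q)⁻¹ * (hT.toFinset.card : ℝ≥0∞))
        (𝓝[<] q₀) (𝓝 0) := by
      have := ENNReal.Tendsto.mul_const (b := (hT.toFinset.card : ℝ≥0∞)) htop.inv
        (Or.inr (ENNReal.natCast_ne_top _))
      simpa using this
    refine tendsto_of_tendsto_of_tendsto_of_le_of_le' tendsto_const_nhds h2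
      (.of_forall fun _ => zero_le) ?_
    filter_upwards [hu, self_mem_nhdsWithin] with q hq hq'
    rw [hq, Measure.map_apply hmeas hcl.isOpen.measurableSet]
    exact S.discreteMeasure_le_of_finite ((le_of_lt hq').trans hq₀) hT
  have hemb := measurableEmbedding_toGen (I := I)
  have hmap : ((μ : Measure (GenTrace I)).comap Boundary.toGen).map Boundary.toGen = μ := by
    rw [hemb.map_comap]
    refine Measure.restrict_eq_self_of_ae_mem ?_
    rw [range_toGen]
    simp only [Set.mem_iInter, ae_all_iff]
    intro n
    exact measure_eq_zero_iff_ae_notMem.1 (hnull n)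
  have hprob : IsProbabilityMeasure ((μ : Measure (GenTrace I)).comap Boundary.toGen) := by
    refine ⟨?_⟩
    rw [← Set.preimage_univ (f := Boundary.toGen), ← hemb.map_apply, hmap, measure_univ]
  refine ⟨⟨_, hprob⟩, fun f => ?_, fun x => ?_⟩
  · rw [ProbabilityMeasure.coe_mk, ← hemb.integral_map, hmap]
    refine (ProbabilityMeasure.tendsto_iff_forall_integral_tendsto.1 hμ f).congr' ?_
    filter_upwards [hu] with q hq
    rw [hq, integral_map hmeas.aemeasurable f.continuous.aestronglyMeasurable]
  · rw [ProbabilityMeasure.coe_mk, ← preimage_genCylinder, ← hemb.map_apply, hmap, hμL]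

/-- The weak limit of the measures `m_{s,q}` is determined by its integrals of continuous
functions. -/
theorem ext_of_integral_toGen {μ ν : ProbabilityMeasure (Boundary I)}
    (h : ∀ f : GenTrace I →ᵇ ℝ, ∫ ξ, f ξ.toGen ∂(μ : Measure (Boundary I)) =
      ∫ ξ, f ξ.toGen ∂(ν : Measure (Boundary I))) : μ = ν := by
  have hemb := measurableEmbedding_toGen (I := I)
  have h1 : (μ : Measure (Boundary I)).map Boundary.toGen =
      (ν : Measure (Boundary I)).map Boundary.toGen := by
    have := Measure.isProbabilityMeasure_map (μ := (μ : Measure (Boundary I)))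
      hemb.measurable.aemeasurable
    have := Measure.isProbabilityMeasure_map (μ := (ν : Measure (Boundary I)))
      hemb.measurable.aemeasurable
    refine ext_of_forall_integral_eq_of_IsFiniteMeasure fun f => ?_
    rw [hemb.integral_map, hemb.integral_map]
    exact h f
  refine Subtype.ext ?_
  have := congrArg (Measure.comap Boundary.toGen) h1
  rwa [hemb.comap_map, hemb.comap_map] at this

end AsyncSystem

end Measures

/-! ### The uniform measure of the net and its cocycle -/

section Example

open Classical in
/-- The cocycle of the uniform measure of the net. -/
noncomputable def netCocycle (s t : net.State) : ℝ :=
  if s = t then 1 else if s = M₀ then √2 else 1 / √2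

theorem netCocycle_self (s : net.State) : netCocycle s s = 1 := if_pos rfl

theorem netCocycle_M₀_M₁ : netCocycle M₀ M₁ = √2 := by simp [netCocycle, M₀_ne_M₁]

theorem netCocycle_M₁_M₀ : netCocycle M₁ M₀ = 1 / √2 := by simp [netCocycle, M₀_ne_M₁.symm]

theorem netCocycle_pos (s t : net.State) : 0 < netCocycle s t := by
  unfold netCocycle
  split_ifs <;> positivity

theorem netCocycle_mul (s t u : net.State) :
    netCocycle s u = netCocycle s t * netCocycle t u := by
  have h : √2 ≠ 0 := by positivity
  rcases eq_M₀_or_eq_M₁ s with rfl | rfl <;> rcases eq_M₀_or_eq_M₁ t with rfl | rfl <;>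
    rcases eq_M₀_or_eq_M₁ u with rfl | rfl <;>
    simp [netCocycle_self, netCocycle_M₀_M₁, netCocycle_M₁_M₀, h]

theorem tendsto_toReal_growth_div (s t : net.State) :
    Tendsto (fun q => (evalSeries (net.system.growth t) q).toReal /
      (evalSeries (net.system.growth s) q).toReal) (𝓝[<] (√2 - 1)) (𝓝 (netCocycle s t)) := by
  by_cases hst : s = t
  · subst hst
    rw [netCocycle_self]
    refine tendsto_const_nhds.congr' ?_
    filter_upwards [(tendsto_evalSeries_growth s).eventually_ne_atTop 0] with q hq
    rw [div_self hq]
  · have h := tendsto_evalSeries_growth_div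
    rcases eq_M₀_or_eq_M₁ s with rfl | rfl <;> rcases eq_M₀_or_eq_M₁ t with rfl | rfl
    · exact absurd rfl hst
    · rwa [netCocycle_M₀_M₁]
    · rw [netCocycle_M₁_M₀, one_div]
      simpa only [inv_div] using h.inv₀ (by positivity)
    · exact absurd rfl hst

theorem tendsto_evalSeries_growth_top (s : net.State) :
    Tendsto (fun q => evalSeries (net.system.growth s) q) (𝓝[<] (√2 - 1)) (𝓝 ⊤) := by
  refine (ENNReal.tendsto_ofReal_atTop.comp (tendsto_evalSeries_growth s)).congr' ?_
  filter_upwards [self_mem_nhdsWithin] with q hq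
  exact ENNReal.ofReal_toReal (evalSeries_growth_lt_top hq s).ne

/-- The masses of the cylinders for the uniform measure of the net. -/
noncomputable def netMass (s : net.State) (x : Trace net.indep) : ℝ≥0∞ :=
  (net.system.act (some s) x).elim 0 fun t =>
    ENNReal.ofReal ((√2 - 1) ^ x.length * netCocycle s t)

theorem tendsto_discreteMeasure_dvd (s : net.State) (x : Trace net.indep) :
    Tendsto (fun q => net.system.discreteMeasure s q {y | x ∣ y}) (𝓝[<] (√2 - 1))
      (𝓝 (netMass s x)) := by
  cases h : net.system.act (some s) x with
  | none =>
    simp only [net.system.discreteMeasure_dvd_of_eq_none h, netMass, h]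
    exact tendsto_const_nhds
  | some t =>
    simp only [net.system.discreteMeasure_dvd_of_eq_some h, netMass, h]
    have hq : Tendsto (fun q : ℝ => q ^ x.length) (𝓝[<] (√2 - 1)) (𝓝 ((√2 - 1) ^ x.length)) :=
      ((continuous_pow x.length).tendsto _).mono_left nhdsWithin_le_nhds
    refine (ENNReal.tendsto_ofReal (hq.mul (tendsto_toReal_growth_div s t))).congr' ?_
    filter_upwards [Ioo_mem_nhdsLT net_isCharacteristicRoot.1.1,
      (tendsto_evalSeries_growth s).eventually_gt_atTop 0] with q hq hs
    rw [ENNReal.ofReal_mul (pow_nonneg hq.1.le _), ENNReal.ofReal_pow hq.1.le,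
      ENNReal.ofReal_div_of_pos hs, ENNReal.ofReal_toReal (evalSeries_growth_lt_top hq.2 s).ne,
      ENNReal.ofReal_toReal (evalSeries_growth_lt_top hq.2 t).ne, div_eq_mul_inv]

theorem exists_net_uniformMeasure : ∃ ν : net.State → ProbabilityMeasure (Boundary net.indep),
    net.system.IsUniformMeasure ν ∧
      ∀ s x, (ν s : Measure (Boundary net.indep)) (visualCylinder x) = netMass s x := by
  choose ν hν hm using fun s => net.system.exists_tendsto_discreteMeasure (s := s)
    net_isCharacteristicRoot.1.2 (fun q hq => (evalSeries_growth_lt_top hq s).ne)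
    (tendsto_evalSeries_growth_top s) (tendsto_discreteMeasure_dvd s)
  exact ⟨ν, ⟨_, net_isCharacteristicRoot, hν⟩, hm⟩

theorem net_uniformMeasure_unique {ν ν' : net.State → ProbabilityMeasure (Boundary net.indep)}
    (h : net.system.IsUniformMeasure ν) (h' : net.system.IsUniformMeasure ν') : ν' = ν := by
  obtain ⟨q, hq, hν⟩ := h
  obtain ⟨q', hq', hν'⟩ := h'
  obtain rfl : q' = q :=
    (eq_of_isCharacteristicRoot hq').trans (eq_of_isCharacteristicRoot hq).symm
  exact funext fun s => AsyncSystem.ext_of_integral_toGen fun f =>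
    tendsto_nhds_unique (hν' s f) (hν s f)

end Example

end AsyncNet

open AsyncNet

theorem mainTheorem1 :
    -- the net is safe, with exactly two reachable markings
    net.Safe ∧ M₀ ≠ M₁ ∧ (∀ M : net.State, M = M₀ ∨ M = M₁) ∧
    -- the associated trace monoid
    (∀ t t' : Tr, net.indep.Adj t t' ↔
      s(t, t') ∈ ({s(Tr.a, Tr.d), s(Tr.a, Tr.e), s(Tr.b, Tr.d), s(Tr.b, Tr.e), s(Tr.c, Tr.e)} : Set (Sym2 Tr))) ∧
    -- the action, which is irreducible
    ((net.system.act (some M₀) (letter _ Tr.a) = some M₀ ∧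
      net.system.act (some M₀) (letter _ Tr.b) = some M₁ ∧
      net.system.act (some M₀) (letter _ Tr.c) = none ∧
      net.system.act (some M₀) (letter _ Tr.d) = some M₀ ∧
      net.system.act (some M₀) (letter _ Tr.e) = some M₀) ∧
     (net.system.act (some M₁) (letter _ Tr.a) = none ∧
      net.system.act (some M₁) (letter _ Tr.b) = none ∧
      net.system.act (some M₁) (letter _ Tr.c) = some M₀ ∧
      net.system.act (some M₁) (letter _ Tr.d) = some M₁ ∧
      net.system.act (some M₁) (letter _ Tr.e) = some M₁)) ∧
    net.system.Irreducible ∧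
    -- the Möbius matrix and the theta polynomial
    (net.system.mobiusMatrix M₀ M₀ = 1 - 3 * Polynomial.X + 2 * Polynomial.X ^ 2 ∧
      net.system.mobiusMatrix M₀ M₁ = -Polynomial.X + 2 * Polynomial.X ^ 2 ∧
      net.system.mobiusMatrix M₁ M₀ = -Polynomial.X + Polynomial.X ^ 2 ∧
      net.system.mobiusMatrix M₁ M₁ = 1 - 2 * Polynomial.X) ∧
    net.system.theta = (1 - Polynomial.X) * (1 - 2 * Polynomial.X) *
      (1 - 2 * Polynomial.X - Polynomial.X ^ 2) ∧
    -- the characteristic root, which is the smallest positive root of the theta polynomial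
    net.system.IsCharacteristicRoot (√2 - 1) ∧
    IsLeast {z : ℝ | 0 < z ∧ Polynomial.aeval z net.system.theta = 0} (√2 - 1) ∧
    -- the uniform measure exists and is unique, has a unique cocycle, and both are as claimed
    ∃ ν : net.State → ProbabilityMeasure (Boundary net.indep),
      net.system.IsUniformMeasure ν ∧ (∀ ν', net.system.IsUniformMeasure ν' → ν' = ν) ∧
      (∃ Γ : net.State → net.State → ℝ,
        net.system.IsCocycleOf ν Γ ∧ (∀ Γ', net.system.IsCocycleOf ν Γ' → Γ' = Γ) ∧
        Γ M₀ M₁ = √2 ∧ Γ M₁ M₀ = 1 / √2 ∧ Γ M₀ M₀ = 1 ∧ Γ M₁ M₁ = 1) ∧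
      (∀ x : Trace net.indep,
        (net.system.act (some M₀) x = some M₀ →
          (ν M₀ : Measure _).real (visualCylinder x) = (√2 - 1) ^ x.length) ∧
        (net.system.act (some M₀) x = some M₁ →
          (ν M₀ : Measure _).real (visualCylinder x) = √2 * (√2 - 1) ^ x.length) ∧
        (net.system.act (some M₀) x = none →
          (ν M₀ : Measure _).real (visualCylinder x) = 0)) ∧
      (∀ x : Trace net.indep,
        (net.system.act (some M₁) x = some M₁ →
          (ν M₁ : Measure _).real (visualCylinder x) = (√2 - 1) ^ x.length) ∧
        (net.system.act (some M₁) x = some M₀ →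
          (ν M₁ : Measure _).real (visualCylinder x) = 1 / √2 * (√2 - 1) ^ x.length) ∧
        (net.system.act (some M₁) x = none →
          (ν M₁ : Measure _).real (visualCylinder x) = 0)) := by
  obtain ⟨ν, hν, hm⟩ := exists_net_uniformMeasure
  have hq := net_isCharacteristicRoot.1.1
  have hsome : ∀ s t (x : Trace net.indep), net.system.act (some s) x = some t →
      (ν s : Measure _).real (visualCylinder x) = (√2 - 1) ^ x.length * netCocycle s t := by
    intro s t x h
    rw [measureReal_def, hm, netMass, h, Option.elim_some, ENNReal.toReal_ofReal]
    exact mul_nonneg (pow_nonneg hq.le _) (netCocycle_pos s t).le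
  have hnone : ∀ s (x : Trace net.indep), net.system.act (some s) x = none →
      (ν s : Measure _).real (visualCylinder x) = 0 := by
    intro s x h
    rw [measureReal_def, hm, netMass, h, Option.elim_none, ENNReal.toReal_zero]
  refine ⟨net_safe, M₀_ne_M₁, eq_M₀_or_eq_M₁, net_indep_iff, ⟨act_M₀, act_M₁⟩, net_irreducible,
    net_mobiusMatrix, net_theta, net_isCharacteristicRoot, net_isLeast, ν, hν,
    fun ν' => net_uniformMeasure_unique hν, ⟨netCocycle, ⟨netCocycle_pos, netCocycle_mul, _,
      net_isCharacteristicRoot, hsome⟩, ?_, netCocycle_M₀_M₁, netCocycle_M₁_M₀,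
      netCocycle_self _, netCocycle_self _⟩, fun x => ⟨fun h => ?_, fun h => ?_, hnone _ x⟩,
    fun x => ⟨fun h => ?_, fun h => ?_, hnone _ x⟩⟩
  · rintro Γ' ⟨-, -, q, hq', h⟩
    obtain rfl := eq_of_isCharacteristicRoot hq'
    funext s t
    -- By irreducibility every pair `(s, t)` is realized by some trace `x`, whose cylinder mass
    -- determines the value at `(s, t)` after division by the positive number `q₀^|x|`.
    obtain ⟨x, -, hx⟩ := net_irreducible s t
    exact mul_left_cancel₀ (pow_pos hq x.length).ne' ((h s t x hx).symm.trans (hsome s t x hx))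
  · rw [hsome _ _ x h, netCocycle_self, mul_one]
  · rw [hsome _ _ x h, netCocycle_M₀_M₁, mul_comm]
  · rw [hsome _ _ x h, netCocycle_self, mul_one]
  · rw [hsome _ _ x h, netCocycle_M₁_M₀, mul_comm]
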